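/- **Notation.** Let $\mathbb F$ be a field of characteristic $p$. The divided power algebra $\mathcal O(2;(n_1,n_2))$ has basis $x^{(i)}y^{(j)}$, $0\le i<p^{n_1}$, $0\le j<p^{n_2}$, with product $x^{(i)}y^{(j)}x^{(k)}y^{(l)}=\binom{i+k}{i}\binom{j+l}{j}x^{(i+k)}y^{(j+l)}$ (monomials outside the range are $0$). Put $\bar x=x^{(p^{n_1}-1)}$. The Albert–Zassenhaus algebra $H(2;(n_1,n_2);\Phi(1))$ is the space $\mathcal O(2;(n_1,n_2))$ with the Lie bracket $$\{x^{(i)}y^{(j)},x^{(k)}y^{(l)}\}=\Big(\tbinom{i+k-1}{i}\tbinom{j+l-1}{j-1}-\tbinom{i+k-1}{i-1}\tbinom{j+l-1}{j}\Big)x^{(i+k-1)}y^{(j+l-1)}\quad\text{if } i+k>0,$$ $$\{y^{(j)},y^{(l)}\}=\Big(\tbinom{j+l-1}{l}-\tbinom{j+l-1}{j}\Big)\bar x\,y^{(j+l-1)}.$$ For $u$ with $u^p=0$ and $\alpha\in\mathbb F$, $(1+u)^\alpha=\sum_{i=0}^{p-1}\binom{\alpha}{i}u^i$. If a finite-dimensional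 Lie algebra $S=\bigoplus_{k\in\mathbb Z/N\mathbb Z}S_k$ is graded over $\mathbb Z/N\mathbb Z$, its *loop algebra* is the Lie subalgebra $L$ of $S\otimes\mathbb F[T]$ generated by $S_{\bar 1}\otimes T$, with $L_i=L\cap(S_{\bar i}\otimes T^i)$. A graded Lie algebra $L=\bigoplus_{i\ge1}L_i$ is *thin* if $\dim L_1=2$, $[u,L_1]=L_{i+1}$ for all $i\ge1$ and $0\ne u\in L_i$, $L$ is infinite-dimensional, and $L_1$ is not the only component of dimension two. Components of dimension two are called *diamonds*, and $L_1$ is the first one. Write $[a,b,c]=[[a,b],c]$. If the second diamond of $L$ is $L_q$, call $X,Y$ *standard generators* if they form a basis of $L_1$, $[V,X,X]=0=[V,Y,Y]$ and $[V,Y,X]=-2[V,X,Y]$ for $V\in L_{q-1}$, and, when $q>3$, $[L_2,Y]=0$. A diamond $L_i$ with $i>1$ and $\dim L_{i-1}=1$ has *type* $\mu\in\mathbb F$ (with respect to $X,Y$) if $[V,X,X]=0=[V,Y,Y]$ and $(1-\mu)[V,X,Y]=\mu[V,Y,X]$ for $V\in L_{i-1}$; it has type $\infty$ if $[V,X,X]=0=[V,Y,Y]$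 and $-[V,X,Y]=[V,Y,X]$ for $V\in L_{i-1}$. **Theorem.** Let $\mathbb F$ be a field of odd characteristic $p$, let $n,s$ be positive integers, and set $q=p^n$. Suppose that $\sigma,\pi\in\mathbb F$ satisfy $(\pi^p-\pi)\sigma^p=1$. Then the elements $$e_{j,k,a}=(1+\sigma x^{(p^s)})^{-j\pi+a}\,x^{(k+1)}y^{(j+1)},\qquad -1\le j<q-1,\ -1\le k<p^s-1,\ a\in\mathbb F_p,$$ form a basis of $H(2;(s+1,n);\Phi(1))$, and this Lie algebra is graded over the integers modulo $(q-1)p^{s+1}$ by giving $e_{j,k,a}$ the degree $(1-q)(ap^s+k)-j \bmod (q-1)p^{s+1}$. The corresponding loop algebra $L$ is thin, with second diamond in degree $q$. Its diamonds are exactly the components in the degrees $t(q-1)+1$, $t\ge 0$. There exist standard generators $X,Y$ such that, with respect to them, the following hold; if $q>3$, they hold with respect to all standard generators $X,Y$. 1. For each $t\ge1$ the diamond in degree $t(q-1)+1$ has exactly one type in $\mathbb F\cup\{\infty\}$, and this type is finite if and only if $t\equiv1\pmod{p^s}$. 2. The finite types, that is, those of the diamonds in degrees $(q-1)(mp^s+1)+1$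 for $m=0,1,2,\dots$, form an arithmetic progression that is not contained in the prime field $\mathbb F_p$. 3. The diamond in degree $(q-1)(p^s+1)+1$ has type $-1+1/\pi$. -/

import Mathlib

open scoped TensorProduct Polynomial

set_option linter.unusedSectionVars false

noncomputable section

/-! ### Divided power algebras in one variable -/

/-- The underlying space of the divided power algebra `O(1; m)` over `F` (for the prime `p`):
`f` stands for `∑ f i • x^(i)`, where `i` runs over `0, …, p ^ m - 1`. -/
def DivPow (F : Type*) (p m : ℕ) : Type _ := Fin (p ^ m) → F

namespace DivPow

variable {F : Type*} [Field F] {p m : ℕ}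

instance : AddCommGroup (DivPow F p m) := inferInstanceAs (AddCommGroup (Fin (p ^ m) → F))
instance : Module F (DivPow F p m) := inferInstanceAs (Module F (Fin (p ^ m) → F))

@[ext] theorem ext {f g : DivPow F p m} (h : ∀ t, f t = g t) : f = g := funext h

@[simp] theorem add_apply (f g : DivPow F p m) (t) : (f + g) t = f t + g t := rfl
@[simp] theorem smul_apply (c : F) (f : DivPow F p m) (t) : (c • f) t = c * f t := rfl
@[simp] theorem zero_apply (t) : (0 : DivPow F p m) t = 0 := rfl

variable (F p m) in
/-- The divided power `x^(i)`; it is `0` when `i ≥ p ^ m`. -/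
def dp (i : ℕ) : DivPow F p m := fun t => if t.val = i then 1 else 0

theorem dp_of_le {i : ℕ} (h : p ^ m ≤ i) : dp F p m i = 0 := by
  ext t
  have := t.2
  simp only [dp, zero_apply, ite_eq_right_iff]
  omega

theorem eq_sum (f : DivPow F p m) : f = ∑ i, f i • dp F p m i := by
  ext t
  have : (∑ i, f i • dp F p m i) t = ∑ i, (f i • dp F p m i) t := Finset.sum_apply _ _ _
  rw [this]
  rw [Finset.sum_eq_single t]
  · simp [dp]
  · intro b _ hb
    have : t.val ≠ b.val := fun h => hb (Fin.ext h.symm)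
    simp [dp, this]
  · simp

theorem induction {P : DivPow F p m → Prop} (h0 : P 0) (hadd : ∀ f g, P f → P g → P (f + g))
    (hsmul : ∀ (c : F) f, P f → P (c • f)) (hdp : ∀ i, i < p ^ m → P (dp F p m i))
    (f : DivPow F p m) : P f := by
  rw [eq_sum f]
  exact Finset.sum_induction _ P hadd h0 (fun i _ => hsmul _ _ (hdp i i.2))

/-- The product with `x^(i) x^(j) = binom(i+j, i) x^(i+j)`. -/
instance : Mul (DivPow F p m) where
  mul f g := ∑ i : Fin (p ^ m), ∑ j : Fin (p ^ m),
    (f i * g j * ((i.val + j.val).choose i.val : F)) • dp F p m (i.val + j.val)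

theorem mul_def (f g : DivPow F p m) : f * g = ∑ i : Fin (p ^ m), ∑ j : Fin (p ^ m),
    (f i * g j * ((i.val + j.val).choose i.val : F)) • dp F p m (i.val + j.val) := rfl

instance : One (DivPow F p m) := ⟨dp F p m 0⟩

theorem one_def : (1 : DivPow F p m) = dp F p m 0 := rfl

theorem dp_mul_dp (i j : ℕ) :
    dp F p m i * dp F p m j = ((i + j).choose i : F) • dp F p m (i + j) := by
  by_cases hi : i < p ^ m
  · by_cases hj : j < p ^ m
    · rw [mul_def, Finset.sum_eq_single ⟨i, hi⟩, Finset.sum_eq_single ⟨j, hj⟩]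
      · simp [dp]
      · intro b _ hb
        have : b.val ≠ j := fun h => hb (Fin.ext h)
        simp [dp, this]
      · simp
      · intro b _ hb
        have : b.val ≠ i := fun h => hb (Fin.ext h)
        simp [dp, this]
      · simp
    · rw [dp_of_le (i := j) (by omega), dp_of_le (i := i + j) (by omega)]
      simp [mul_def]
  · rw [dp_of_le (i := i) (by omega), dp_of_le (i := i + j) (by omega)]
    simp [mul_def]

protected theorem zero_mul' (f : DivPow F p m) : 0 * f = 0 := by simp [mul_def]

protected theorem mul_comm' (f g : DivPow F p m) : f * g = g * f := by
  rw [mul_def, mul_def, Finset.sum_comm]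
  refine Finset.sum_congr rfl fun i _ => Finset.sum_congr rfl fun j _ => ?_
  rw [Nat.add_comm j.val, Nat.choose_symm_add, mul_comm (f j)]

protected theorem add_mul' (f g h : DivPow F p m) : (f + g) * h = f * h + g * h := by
  simp [mul_def, add_mul, add_smul, Finset.sum_add_distrib]

protected theorem smul_mul' (c : F) (f h : DivPow F p m) : (c • f) * h = c • (f * h) := by
  simp [mul_def, Finset.smul_sum, smul_smul, mul_assoc]

protected theorem mul_add' (f g h : DivPow F p m) : f * (g + h) = f * g + f * h := by
  rw [DivPow.mul_comm', DivPow.add_mul', DivPow.mul_comm' g, DivPow.mul_comm' h]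

protected theorem mul_smul' (c : F) (f h : DivPow F p m) : f * (c • h) = c • (f * h) := by
  rw [DivPow.mul_comm', DivPow.smul_mul', DivPow.mul_comm' h]

protected theorem mul_zero' (f : DivPow F p m) : f * 0 = 0 := by simp [mul_def]

protected theorem one_mul' (f : DivPow F p m) : 1 * f = f := by
  induction f using induction with
  | h0 => exact DivPow.mul_zero' _
  | hadd f g hf hg => rw [DivPow.mul_add', hf, hg]
  | hsmul c f hf => rw [DivPow.mul_smul', hf]
  | hdp i hi => simp [one_def, dp_mul_dp]

protected theorem mul_assoc' (f g h : DivPow F p m) : f * g * h = f * (g * h) := by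
  induction f using induction with
  | h0 => simp [DivPow.zero_mul']
  | hadd f f' hf hf' => simp only [DivPow.add_mul', hf, hf']
  | hsmul c f hf => simp only [DivPow.smul_mul', hf]
  | hdp i hi =>
  induction g using induction with
  | h0 => simp [DivPow.zero_mul', DivPow.mul_zero']
  | hadd f f' hf hf' => simp only [DivPow.add_mul', DivPow.mul_add', hf, hf']
  | hsmul c f hf => simp only [DivPow.smul_mul', DivPow.mul_smul', hf]
  | hdp j hj =>
  induction h using induction with
  | h0 => simp [DivPow.mul_zero']
  | hadd f f' hf hf' => simp only [DivPow.mul_add', hf, hf']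
  | hsmul c f hf => simp only [DivPow.mul_smul', hf]
  | hdp k hk =>
  simp only [dp_mul_dp, DivPow.smul_mul', DivPow.mul_smul', smul_smul]
  rw [add_assoc]
  congr 1
  have h1 := Nat.choose_mul (n := i + (j + k)) (k := i + j) (s := i) (by omega)
  rw [show i + (j + k) - i = j + k by omega, show i + j - i = j by omega] at h1
  have h2 := congrArg (Nat.cast (R := F)) h1
  push_cast at h2
  rw [mul_comm, h2, mul_comm]

instance : CommRing (DivPow F p m) where
  mul_assoc := DivPow.mul_assoc'
  one_mul := DivPow.one_mul'
  mul_one f := by rw [DivPow.mul_comm']; exact DivPow.one_mul' f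
  left_distrib := DivPow.mul_add'
  right_distrib := DivPow.add_mul'
  zero_mul := DivPow.zero_mul'
  mul_zero := DivPow.mul_zero'
  mul_comm := DivPow.mul_comm'
  neg_add_cancel := neg_add_cancel
  zsmul := (· • ·)
  nsmul := (· • ·)
  zsmul_zero' := SubNegMonoid.zsmul_zero'
  zsmul_succ' := SubNegMonoid.zsmul_succ'
  zsmul_neg' := SubNegMonoid.zsmul_neg'
  nsmul_zero := AddMonoid.nsmul_zero
  nsmul_succ := AddMonoid.nsmul_succ
  sub_eq_add_neg := sub_eq_add_neg

instance : Algebra F (DivPow F p m) :=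
  Algebra.ofModule DivPow.smul_mul' DivPow.mul_smul'

/-- The map with `x^(i) ↦ x^(i-1)` for `0 < i < p ^ m` and `x^(0) ↦ 0`, in coordinates. -/
def derivFun (f : DivPow F p m) : DivPow F p m :=
  fun t => if h : t.val + 1 < p ^ m then f ⟨t.val + 1, h⟩ else 0

theorem derivFun_apply (f : DivPow F p m) (t : Fin (p ^ m)) :
    derivFun f t = if h : t.val + 1 < p ^ m then f ⟨t.val + 1, h⟩ else 0 := rfl

variable (F p m) in
/-- The derivation with `x^(i) ↦ x^(i-1)` for `0 < i < p ^ m` and `x^(0) ↦ 0`. -/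
def deriv : DivPow F p m →ₗ[F] DivPow F p m where
  toFun := derivFun
  map_add' f g := by
    ext t
    by_cases h : t.val + 1 < p ^ m <;> simp [derivFun_apply, h]
  map_smul' c f := by
    ext t
    by_cases h : t.val + 1 < p ^ m <;> simp [derivFun_apply, h]

theorem deriv_apply (f : DivPow F p m) (t : Fin (p ^ m)) :
    deriv F p m f t = if h : t.val + 1 < p ^ m then f ⟨t.val + 1, h⟩ else 0 := rfl

theorem deriv_dp_zero : deriv F p m (dp F p m 0) = 0 := by
  ext t
  simp [deriv_apply, dp]

theorem deriv_dp_succ {i : ℕ} (hi : i + 1 < p ^ m) :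
    deriv F p m (dp F p m (i + 1)) = dp F p m i := by
  ext t
  have := t.2
  by_cases h : t.val = i
  · simp [deriv_apply, dp, h, hi]
  · simp [deriv_apply, dp, h]

theorem deriv_mul [Fact p.Prime] [CharP F p] (f g : DivPow F p m) :
    deriv F p m (f * g) = deriv F p m f * g + f * deriv F p m g := by
  induction f using induction with
  | h0 => simp
  | hadd f f' hf hf' => simp only [add_mul, map_add, hf, hf']; ring
  | hsmul c f hf => simp only [smul_mul_assoc, map_smul, hf, smul_add]
  | hdp i hi =>
  induction g using induction with
  | h0 => simp
  | hadd f f' hf hf' => simp only [mul_add, map_add, hf, hf']; ring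
  | hsmul c f hf => simp only [mul_smul_comm, map_smul, hf, smul_add]
  | hdp j hj =>
  rcases i with _ | i
  · rw [deriv_dp_zero, ← one_def]; simp
  rcases j with _ | j
  · rw [deriv_dp_zero, ← one_def]; simp
  rw [deriv_dp_succ hi, deriv_dp_succ hj, dp_mul_dp, dp_mul_dp, dp_mul_dp, map_smul]
  have e1 : i + (j + 1) = i + j + 1 := by omega
  have e2 : i + 1 + j = i + j + 1 := by omega
  have e3 : i + 1 + (j + 1) = i + j + 1 + 1 := by omega
  rw [e1, e2, e3, ← add_smul]
  have pas : ((i + j + 1 + 1).choose (i + 1) : F)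
      = ((i + j + 1).choose i : F) + ((i + j + 1).choose (i + 1) : F) := by
    rw [Nat.choose_succ_succ]; push_cast; ring
  rcases lt_trichotomy (i + j + 1 + 1) (p ^ m) with h | h | h
  · rw [deriv_dp_succ h, pas]
  · rw [← pas, dp_of_le (i := i + j + 1 + 1) (by omega), map_zero, smul_zero, h]
    have : p ∣ (p ^ m).choose (i + 1) :=
      (Fact.out : p.Prime).dvd_choose_pow (by omega) (by omega)
    rw [(CharP.cast_eq_zero_iff F p _).2 this, zero_smul]
  · rw [dp_of_le (i := i + j + 1 + 1) (by omega), dp_of_le (i := i + j + 1) (by omega)]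
    simp

end DivPow

/-! ### Divided power algebras in two variables -/

/-- `O(2; (n₁, n₂)) = O(1; n₁) ⊗ O(1; n₂)`. -/
abbrev DivPow₂ (F : Type*) [Field F] (p n₁ n₂ : ℕ) : Type _ := DivPow F p n₁ ⊗[F] DivPow F p n₂

namespace DivPow₂

variable (F : Type*) [Field F] (p n₁ n₂ : ℕ)

/-- The monomial `x^(i) y^(j)`. -/
def mono (i j : ℕ) : DivPow₂ F p n₁ n₂ := DivPow.dp F p n₁ i ⊗ₜ[F] DivPow.dp F p n₂ j

/-- `∂/∂x`. -/
def dx : DivPow₂ F p n₁ n₂ →ₗ[F] DivPow₂ F p n₁ n₂ :=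
  TensorProduct.map (DivPow.deriv F p n₁) LinearMap.id

/-- `∂/∂y`. -/
def dy : DivPow₂ F p n₁ n₂ →ₗ[F] DivPow₂ F p n₁ n₂ :=
  TensorProduct.map LinearMap.id (DivPow.deriv F p n₂)

/-- The monomial `x̄ = x^(p ^ n₁ - 1)`. -/
def xbar : DivPow₂ F p n₁ n₂ := mono F p n₁ n₂ (p ^ n₁ - 1) 0

variable {F p n₁ n₂}

theorem mono_mul_mono (i j k l : ℕ) : mono F p n₁ n₂ i j * mono F p n₁ n₂ k l =
    (((i + k).choose i : F) * ((j + l).choose j : F)) • mono F p n₁ n₂ (i + k) (j + l) := by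
  rw [mono, mono, Algebra.TensorProduct.tmul_mul_tmul, DivPow.dp_mul_dp, DivPow.dp_mul_dp,
    TensorProduct.smul_tmul_smul, mono]

theorem dx_mul [Fact p.Prime] [CharP F p] (f g : DivPow₂ F p n₁ n₂) :
    dx F p n₁ n₂ (f * g) = dx F p n₁ n₂ f * g + f * dx F p n₁ n₂ g := by
  induction f using TensorProduct.induction_on with
  | zero => simp
  | add f f' hf hf' => simp only [add_mul, map_add, hf, hf']; ring
  | tmul a b =>
  induction g using TensorProduct.induction_on with
  | zero => simp
  | add f f' hf hf' => simp only [mul_add, map_add, hf, hf']; ring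
  | tmul c d => simp [dx, DivPow.deriv_mul, TensorProduct.add_tmul]

theorem dy_mul [Fact p.Prime] [CharP F p] (f g : DivPow₂ F p n₁ n₂) :
    dy F p n₁ n₂ (f * g) = dy F p n₁ n₂ f * g + f * dy F p n₁ n₂ g := by
  induction f using TensorProduct.induction_on with
  | zero => simp
  | add f f' hf hf' => simp only [add_mul, map_add, hf, hf']; ring
  | tmul a b =>
  induction g using TensorProduct.induction_on with
  | zero => simp
  | add f f' hf hf' => simp only [mul_add, map_add, hf, hf']; ring
  | tmul c d => simp [dy, DivPow.deriv_mul, TensorProduct.tmul_add]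

theorem dx_dy (f : DivPow₂ F p n₁ n₂) :
    dx F p n₁ n₂ (dy F p n₁ n₂ f) = dy F p n₁ n₂ (dx F p n₁ n₂ f) := by
  induction f using TensorProduct.induction_on with
  | zero => simp
  | add f f' hf hf' => simp only [map_add, hf, hf']
  | tmul a b => simp [dx, dy]

theorem dy_xbar : dy F p n₁ n₂ (xbar F p n₁ n₂) = 0 := by
  simp [dy, xbar, mono, DivPow.deriv_dp_zero]

end DivPow₂

/-- `(1 + u) ^ α = ∑_{i < p} binom(α, i) u ^ i` for `u` in a commutative algebra over a field of
characteristic `p` and an exponent `α` in the field (used when `u ^ p = 0`);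
here `binom(α, i) = α (α - 1) ⋯ (α - i + 1) / i!`. -/
def onePlusPow {F A : Type*} [Field F] [CommRing A] [Algebra F A] (p : ℕ) (u : A) (α : F) : A :=
  ∑ i ∈ Finset.range p, ((descPochhammer F i).eval α / (i.factorial : F)) • u ^ i

/-! ### Albert-Zassenhaus algebras -/

/-- The underlying space of the Albert-Zassenhaus algebra `H(2; (n₁, n₂); Φ(1))`,
a copy of `O(2; (n₁, n₂))`. -/
def AlbertZassenhaus (F : Type*) [Field F] (p n₁ n₂ : ℕ) : Type _ := DivPow₂ F p n₁ n₂

namespace AlbertZassenhaus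

variable {F : Type*} [Field F] {p n₁ n₂ : ℕ}

instance : AddCommGroup (AlbertZassenhaus F p n₁ n₂) :=
  inferInstanceAs (AddCommGroup (DivPow₂ F p n₁ n₂))
instance : Module F (AlbertZassenhaus F p n₁ n₂) :=
  inferInstanceAs (Module F (DivPow₂ F p n₁ n₂))

/-- The identification of the vector space `O(2; (n₁, n₂))` with `H(2; (n₁, n₂); Φ(1))`. -/
def of : DivPow₂ F p n₁ n₂ ≃ₗ[F] AlbertZassenhaus F p n₁ n₂ := LinearEquiv.refl F _

open DivPow₂ in
/-- The bracket `{f, g} = (∂f/∂y) (∂g/∂x + x̄ g) - (∂f/∂x + x̄ f) (∂g/∂y)`, that is, the Poisson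
bracket modified by letting the `x`-derivative send `x^(0)` to `x̄`. Its values on monomials are
computed in `lie_mono`, `lie_mono_exception` and `lie_mono_pure_x` below. -/
def poisson (f g : DivPow₂ F p n₁ n₂) : DivPow₂ F p n₁ n₂ :=
  dy F p n₁ n₂ f * (dx F p n₁ n₂ g + xbar F p n₁ n₂ * g)
    - (dx F p n₁ n₂ f + xbar F p n₁ n₂ * f) * dy F p n₁ n₂ g

open DivPow₂ in
instance [Fact p.Prime] [CharP F p] : LieRing (AlbertZassenhaus F p n₁ n₂) where
  bracket f g := of (poisson (of.symm f) (of.symm g))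
  add_lie f g h := by
    rw [← map_add]; congr 1
    simp only [poisson, map_add]; ring
  lie_add f g h := by
    rw [← map_add]; congr 1
    simp only [poisson, map_add]; ring
  lie_self f := by
    change of _ = 0
    rw [poisson, mul_comm, sub_self, map_zero]
  leibniz_lie f g h := by
    rw [← map_add]; congr 1
    change poisson (of.symm f) (poisson (of.symm g) (of.symm h))
      = poisson (poisson (of.symm f) (of.symm g)) (of.symm h)
        + poisson (of.symm g) (poisson (of.symm f) (of.symm h))
    generalize of.symm f = f
    generalize of.symm g = g
    generalize of.symm h = h
    simp only [poisson, map_sub, map_add, dx_mul, dy_mul, dx_dy, dy_xbar]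
    ring

instance [Fact p.Prime] [CharP F p] : LieAlgebra F (AlbertZassenhaus F p n₁ n₂) where
  lie_smul c f g := by
    change of _ = c • of _
    rw [← map_smul]; congr 1
    simp only [poisson, map_smul, mul_smul_comm, ← smul_add, smul_sub]

theorem lie_of [Fact p.Prime] [CharP F p] (f g : DivPow₂ F p n₁ n₂) :
    (⁅of f, of g⁆ : AlbertZassenhaus F p n₁ n₂) = of (poisson f g) := rfl

open DivPow₂ in
theorem dy_mono_zero (i : ℕ) : dy F p n₁ n₂ (mono F p n₁ n₂ i 0) = 0 := by
  simp [dy, mono, DivPow.deriv_dp_zero]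

open DivPow₂ in
theorem dy_mono_succ (i : ℕ) {j : ℕ} (hj : j + 1 < p ^ n₂) :
    dy F p n₁ n₂ (mono F p n₁ n₂ i (j + 1)) = mono F p n₁ n₂ i j := by
  simp [dy, mono, DivPow.deriv_dp_succ hj]

open DivPow₂ in
theorem mono_of_le {i : ℕ} (hi : p ^ n₁ ≤ i) (j : ℕ) : mono F p n₁ n₂ i j = 0 := by
  simp [mono, DivPow.dp_of_le hi]

open DivPow₂ in
theorem dx_add_mono_zero [Fact p.Prime] (j : ℕ) :
    dx F p n₁ n₂ (mono F p n₁ n₂ 0 j) + xbar F p n₁ n₂ * mono F p n₁ n₂ 0 j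
      = mono F p n₁ n₂ (p ^ n₁ - 1) j := by
  rw [xbar, mono_mul_mono]
  simp [dx, mono, DivPow.deriv_dp_zero]

open DivPow₂ in
theorem dx_add_mono_succ {i : ℕ} (hi : i + 1 < p ^ n₁) (j : ℕ) :
    dx F p n₁ n₂ (mono F p n₁ n₂ (i + 1) j) + xbar F p n₁ n₂ * mono F p n₁ n₂ (i + 1) j
      = mono F p n₁ n₂ i j := by
  rw [xbar, mono_mul_mono, mono_of_le (i := p ^ n₁ - 1 + (i + 1)) (by omega)]
  simp [dx, mono, DivPow.deriv_dp_succ hi]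

open DivPow₂ in
theorem lie_mono [Fact p.Prime] [CharP F p] {i j k l : ℕ} (hi : i < p ^ n₁) (hj : j < p ^ n₂)
    (hk : k < p ^ n₁) (hl : l < p ^ n₂) (hik : 0 < i + k) (hjl : 0 < j + l) :
    (⁅of (mono F p n₁ n₂ i j), of (mono F p n₁ n₂ k l)⁆ : AlbertZassenhaus F p n₁ n₂) =
      (((i + k - 1).choose i : F) * ((j + l - 1).choose l : F)
        - ((i + k - 1).choose k : F) * ((j + l - 1).choose j : F)) •
          of (mono F p n₁ n₂ (i + k - 1) (j + l - 1)) := by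
  have hs : ∀ a b : ℕ, (a + b).choose a = (a + b).choose b := fun a b => Nat.choose_symm_add
  rw [lie_of, ← map_smul]
  congr 1
  rw [poisson]
  have hz : ∀ a b c d, p ^ n₁ ≤ a + c →
      mono F p n₁ n₂ a b * mono F p n₁ n₂ c d = 0 := fun a b c d h => by
    rw [mono_mul_mono, mono_of_le h, smul_zero]
  have hm : ∀ a b c d x y, a + c = x → b + d = y →
      mono F p n₁ n₂ a b * mono F p n₁ n₂ c d =
        ((x.choose a : F) * (y.choose d : F)) • mono F p n₁ n₂ x y := by
    rintro a b c d x y rfl rfl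
    rw [mono_mul_mono, hs b d]
  have hA : dy F p n₁ n₂ (mono F p n₁ n₂ i j) * (dx F p n₁ n₂ (mono F p n₁ n₂ k l)
      + xbar F p n₁ n₂ * mono F p n₁ n₂ k l) =
      (((i + k - 1).choose i : F) * ((j + l - 1).choose l : F)) •
        mono F p n₁ n₂ (i + k - 1) (j + l - 1) := by
    rcases j with _ | j
    · rw [dy_mono_zero, zero_mul, Nat.choose_eq_zero_of_lt (show 0 + l - 1 < l by omega)]
      simp
    · rw [dy_mono_succ _ hj]
      rcases k with _ | k
      · rw [dx_add_mono_zero, hz _ _ _ _ (by omega),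
          Nat.choose_eq_zero_of_lt (show i + 0 - 1 < i by omega)]
        simp
      · rw [dx_add_mono_succ hk]
        exact hm _ _ _ _ _ _ (by omega) (by omega)
  have hB : (dx F p n₁ n₂ (mono F p n₁ n₂ i j) + xbar F p n₁ n₂ * mono F p n₁ n₂ i j) *
      dy F p n₁ n₂ (mono F p n₁ n₂ k l) =
      (((i + k - 1).choose k : F) * ((j + l - 1).choose j : F)) •
        mono F p n₁ n₂ (i + k - 1) (j + l - 1) := by
    rcases l with _ | l
    · rw [dy_mono_zero, mul_zero, Nat.choose_eq_zero_of_lt (show j + 0 - 1 < j by omega)]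
      simp
    · rw [dy_mono_succ _ hl, mul_comm]
      rcases i with _ | i
      · rw [dx_add_mono_zero, hz _ _ _ _ (by omega),
          Nat.choose_eq_zero_of_lt (show 0 + k - 1 < k by omega)]
        simp
      · rw [dx_add_mono_succ hi]
        exact hm _ _ _ _ _ _ (by omega) (by omega)
  rw [hA, hB, sub_smul]

open DivPow₂ in
theorem lie_mono_exception [Fact p.Prime] [CharP F p] {j l : ℕ} (hj : j < p ^ n₂)
    (hl : l < p ^ n₂) (hjl : 0 < j + l) :
    (⁅of (mono F p n₁ n₂ 0 j), of (mono F p n₁ n₂ 0 l)⁆ : AlbertZassenhaus F p n₁ n₂) =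
      (((j + l - 1).choose l : F) - ((j + l - 1).choose j : F)) •
          of (mono F p n₁ n₂ (p ^ n₁ - 1) (j + l - 1)) := by
  have hs : ∀ a b : ℕ, (a + b).choose a = (a + b).choose b := fun a b => Nat.choose_symm_add
  rw [lie_of, ← map_smul]
  congr 1
  rw [poisson]
  have hm : ∀ a b c d x y, a + c = x → b + d = y →
      mono F p n₁ n₂ a b * mono F p n₁ n₂ c d =
        ((x.choose a : F) * (y.choose d : F)) • mono F p n₁ n₂ x y := by
    rintro a b c d x y rfl rfl
    rw [mono_mul_mono, hs b d]
  rw [dx_add_mono_zero, dx_add_mono_zero, sub_smul]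
  congr 1
  · rcases j with _ | j
    · rw [dy_mono_zero, zero_mul, Nat.choose_eq_zero_of_lt (show 0 + l - 1 < l by omega)]
      simp
    · rw [dy_mono_succ _ hj, hm _ _ _ _ (p ^ n₁ - 1) (j + 1 + l - 1) (by omega) (by omega)]
      simp
  · rcases l with _ | l
    · rw [dy_mono_zero, mul_zero, Nat.choose_eq_zero_of_lt (show j + 0 - 1 < j by omega)]
      simp
    · rw [dy_mono_succ _ hl, mul_comm,
        hm _ _ _ _ (p ^ n₁ - 1) (j + (l + 1) - 1) (by omega) (by omega)]
      simp

open DivPow₂ in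
theorem lie_mono_pure_x [Fact p.Prime] [CharP F p] (i k : ℕ) :
    (⁅of (mono F p n₁ n₂ i 0), of (mono F p n₁ n₂ k 0)⁆ : AlbertZassenhaus F p n₁ n₂) = 0 := by
  rw [lie_of]
  simp [poisson, dy, mono, DivPow.deriv_dp_zero]

end AlbertZassenhaus
/-! ### The elements `e_{j,k,a}` and the cyclic grading -/

open DivPow₂ in
/-- `e_{j,k,a} = (1 + σ x^(p ^ s)) ^ (-j π + a) x^(k+1) y^(j+1)`, an element of
`H(2; (s+1, n); Φ(1))`. -/
def eElt {F : Type*} [Field F] (p n s : ℕ) [CharP F p] (σ π : F) (j k : ℤ) (a : ZMod p) :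
    AlbertZassenhaus F p (s + 1) n :=
  AlbertZassenhaus.of
    (onePlusPow p (σ • mono F p (s + 1) n (p ^ s) 0) (-(j : F) * π + ZMod.castHom dvd_rfl F a)
      * mono F p (s + 1) n (k + 1).toNat (j + 1).toNat)

/-- The triples `(j, k, a)` with `-1 ≤ j < p ^ n - 1`, `-1 ≤ k < p ^ s - 1` and `a ∈ 𝔽_p`. -/
abbrev EIndex (p n s : ℕ) : Type :=
  Set.Ico (-1 : ℤ) ((p : ℤ) ^ n - 1) × Set.Ico (-1 : ℤ) ((p : ℤ) ^ s - 1) × ZMod p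

/-- The degree `(1 - q) (a p ^ s + k) - j` modulo `(q - 1) p ^ (s + 1)`, where `q = p ^ n`. It does
not depend on the integer that represents `a ∈ 𝔽_p`. -/
def eDeg (p n s : ℕ) (j k : ℤ) (a : ZMod p) : ZMod ((p ^ n - 1) * p ^ (s + 1)) :=
  (((1 - (p : ℤ) ^ n) * ((a.val : ℤ) * (p : ℤ) ^ s + k) - j : ℤ) : ZMod _)

/-- The span of the elements `e_{j,k,a}` of degree `d`. -/
def eComponent {F : Type*} [Field F] (p n s : ℕ) [CharP F p] (σ π : F)
    (d : ZMod ((p ^ n - 1) * p ^ (s + 1))) : Submodule F (AlbertZassenhaus F p (s + 1) n) :=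
  Submodule.span F {z | ∃ i : EIndex p n s, eDeg p n s i.1 i.2.1 i.2.2 = d ∧
    z = eElt p n s σ π i.1 i.2.1 i.2.2}

/-! ### Loop algebras -/

section Loop

variable {F S : Type*} [Field F] [LieRing S] [LieAlgebra F S] {N : ℕ}

/-- The loop algebra of `S = ⨁ S_k`, `k ∈ ℤ/N`: the Lie subalgebra of `F[T] ⊗ S` that is generated
by the elements `T ⊗ u` with `u ∈ S_1`. -/
def cyclicLoopAlgebra (𝒮 : ZMod N → Submodule F S) : LieSubalgebra F (F[X] ⊗[F] S) :=
  LieSubalgebra.lieSpan F (F[X] ⊗[F] S)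
    {z | ∃ u ∈ 𝒮 1, z = (Polynomial.X : F[X]) ⊗ₜ[F] u}

/-- The component of degree `i` of the loop algebra: its elements of the form `T ^ i ⊗ u` with
`u ∈ S_i`, where the index of `S` is read modulo `N`. -/
def loopComponent (𝒮 : ZMod N → Submodule F S) (i : ℕ) : Submodule F (cyclicLoopAlgebra 𝒮) :=
  ((𝒮 (i : ZMod N)).map (TensorProduct.mk F F[X] S (Polynomial.X ^ i))).comap
    (cyclicLoopAlgebra 𝒮).toSubmodule.subtype

end Loop

/-! ### Thin Lie algebras, diamonds and their types -/

section Thin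

variable {F L : Type*} [Field F] [LieRing L] [LieAlgebra F L]

/-- `L = ⨁_{i ≥ 1} L_i` is a thin Lie algebra (`L_0 = 0` is added to the family): `dim L_1 = 2`,
the covering property `[u, L_1] = L_{i+1}` holds for all nonzero `u ∈ L_i`, `L` has infinite
dimension, and `L` is not of maximal class, that is, `L_1` is not the only component of
dimension two. -/
structure IsThin (ℒ : ℕ → Submodule F L) : Prop where
  graded : Nonempty (GradedLieAlgebra ℒ)
  zero : ℒ 0 = ⊥
  finrank_one : Module.finrank F (ℒ 1) = 2
  covering : ∀ i, 1 ≤ i → ∀ u ∈ ℒ i, u ≠ 0 →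
    (ℒ 1).map (LieAlgebra.ad F L u : L →ₗ[F] L) = ℒ (i + 1)
  infinite : ¬ FiniteDimensional F L
  exists_diamond : ∃ i, 1 < i ∧ Module.finrank F (ℒ i) = 2

/-- The component `L_i` is a diamond. -/
def IsDiamond (ℒ : ℕ → Submodule F L) (i : ℕ) : Prop := Module.finrank F (ℒ i) = 2

/-- The second diamond (the first one being `L_1`) is `L_q`. -/
def SecondDiamondAt (ℒ : ℕ → Submodule F L) (q : ℕ) : Prop :=
  1 < q ∧ IsDiamond ℒ q ∧ ∀ i, 1 < i → i < q → ¬ IsDiamond ℒ i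

/-- Generators `X, Y ∈ L_1` of a thin Lie algebra with second diamond `L_q` which serve to define
the diamond types: `X, Y` is a basis of `L_1`, `Y` centralizes `L_2` (when `q > 3`), and
`[V, X, X] = 0 = [V, Y, Y]`, `[V, Y, X] = -2 [V, X, Y]` for `V ∈ L_{q-1}`. When `q > 3` they are
unique up to scalar factors. -/
structure IsNottinghamPair (ℒ : ℕ → Submodule F L) (q : ℕ) (X Y : L) : Prop where
  mem_X : X ∈ ℒ 1
  mem_Y : Y ∈ ℒ 1
  linearIndependent : LinearIndependent F ![X, Y]
  centralizes : 3 < q → ∀ a ∈ ℒ 2, ⁅a, Y⁆ = 0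
  lie_X_X : ∀ V ∈ ℒ (q - 1), ⁅⁅V, X⁆, X⁆ = 0
  lie_Y_Y : ∀ V ∈ ℒ (q - 1), ⁅⁅V, Y⁆, Y⁆ = 0
  lie_Y_X : ∀ V ∈ ℒ (q - 1), ⁅⁅V, Y⁆, X⁆ = (-2 : F) • ⁅⁅V, X⁆, Y⁆

/-- The diamond `L_i`, `i > 1`, has type `τ ∈ F ∪ {∞}` with respect to the generators `X, Y`:
`[V, X, X] = 0 = [V, Y, Y]` for `V` in the one-dimensional component `L_{i-1}`, and
`(1 - μ) [V, X, Y] = μ [V, Y, X]` if `τ = μ ∈ F`, while `-[V, X, Y] = [V, Y, X]` if `τ = ∞`. -/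
structure HasDiamondType (ℒ : ℕ → Submodule F L) (X Y : L) (i : ℕ) (τ : OnePoint F) : Prop where
  one_lt : 1 < i
  isDiamond : IsDiamond ℒ i
  finrank_pred : Module.finrank F (ℒ (i - 1)) = 1
  lie_Y_Y : ∀ V ∈ ℒ (i - 1), ⁅⁅V, Y⁆, Y⁆ = 0
  lie_X_X : ∀ V ∈ ℒ (i - 1), ⁅⁅V, X⁆, X⁆ = 0
  finite : ∀ μ : F, τ = (μ : OnePoint F) → ∀ V ∈ ℒ (i - 1),
    (1 - μ) • ⁅⁅V, X⁆, Y⁆ = μ • ⁅⁅V, Y⁆, X⁆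
  infinite : τ = OnePoint.infty → ∀ V ∈ ℒ (i - 1), -⁅⁅V, X⁆, Y⁆ = ⁅⁅V, Y⁆, X⁆

/-- The pattern of diamond types with respect to `X, Y`, for the diamonds in the degrees
`t (q - 1) + 1` with `t ≥ 1`: each of them has exactly one type in `F ∪ {∞}`; this type is finite
exactly when `t ≡ 1` modulo `r`; the finite types, in the degrees
`(q - 1) (m r + 1) + 1` with `m ≥ 0`, form an arithmetic progression that is not contained in the
prime field; and the diamond in degree `(q - 1) (r + 1) + 1` has type `ν`. -/
structure HasDiamondPattern (ℒ : ℕ → Submodule F L) (X Y : L) (q r : ℕ) (ν : F) : Prop where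
  existsUnique_type : ∀ t, 1 ≤ t → ∃! τ : OnePoint F, HasDiamondType ℒ X Y (t * (q - 1) + 1) τ
  finite_iff : ∀ t, 1 ≤ t → ∀ τ : OnePoint F, HasDiamondType ℒ X Y (t * (q - 1) + 1) τ →
    (τ ≠ OnePoint.infty ↔ t ≡ 1 [MOD r])
  progression : ∃ μ : ℕ → F,
    (∀ m, HasDiamondType ℒ X Y ((q - 1) * (m * r + 1) + 1) (μ m)) ∧
    (∃ d : F, ∀ m, μ (m + 1) = μ m + d) ∧
    (∃ m, μ m ∉ (⊥ : Subfield F))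
  type_nu : HasDiamondType ℒ X Y ((q - 1) * (r + 1) + 1) (ν : OnePoint F)

end Thin

end

/-! Put `m = j + 1` and `t = -(a p^s + k)`. The element `e_{j,k,a}` becomes `tableElt m t`, written
`v m t`, of degree `(q-1)t + 1 - m`, and it depends on `t` only modulo `p^(s+1)`. A component is
spanned either by a single `v m t` with `1 ≤ m ≤ q-2`, or by the pair `v 0 t`, `v (q-1) (t+1)`; the
pairs are the diamonds. In degree one the pair is `X = (1+u)^π x` and `Y = (1+u)^(2π) y^(q-1)`, with
`u = σ x^(p^s)`.

The crux is that brackets of the `v m t` stay in the table. The twisted derivative `∂ + x̄` sends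
`(1+u)^α` to `ασ (1+u)^(α-1) x^(p^s-1)` plus `1 - (α^p-α)σ^p` times `x̄`. For the exponent `α =
-(m-1)π + a`, the relation `(π^p-π)σ^p = 1` turns the coefficient of `x̄` into `m`, and in a bracket
the two such terms cancel by a binomial identity (`lie_tableElt_of_zero`). In all other brackets the
correction terms vanish because a binomial coefficient has a carry.

It follows that `ad X` lowers `m` by one, while `ad Y` acts only at `m = 1` and `m = 0`, by scalars
`d t` and `c t`. These are `1` and `-1` unless `p^s` divides `t - 1`; for `t = 1 + i p^s` they are
`σ(2π - i)` and `-σ(π - i)`. They never vanish, since `π` is outside the prime field. This is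
`isDiamondTable`.

The rest is formal. Nonvanishing of `c`, `d` gives the covering property
(`IsDiamondTable.isCyclicallyCovered`), which makes the loop algebra fill all positive degrees and
passes to it (`IsCyclicallyCovered.isThin`). If `V` precedes the diamond with index `t`, then
`[V,X,Y]` and `[V,Y,X]` are in the ratio `c t : d t`, so the type is `c/(c+d)`, or infinite when `c
+ d = 0` (`hasDiamondType_iff`). At `t = 1 + i p^s` one has `c + d = σπ` and type `-1 + i/π`. -/

noncomputable section

/-! ### Loop algebras of cyclically graded Lie algebras with the covering property. -/

section LoopStructure

variable {F S : Type*} [Field F] [LieRing S] [LieAlgebra F S] {N : ℕ}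

variable (F S) in
/-- The coefficient of `T ^ i` of an element of `F[T] ⊗ S`. -/
def tensorCoeff (i : ℕ) : F[X] ⊗[F] S →ₗ[F] S :=
  (TensorProduct.lid F S).toLinearMap ∘ₗ (Polynomial.lcoeff F i).rTensor S

theorem tensorCoeff_tmul (i : ℕ) (f : F[X]) (u : S) :
    tensorCoeff F S i (f ⊗ₜ[F] u) = f.coeff i • u := by
  simp [tensorCoeff]

theorem tensorCoeff_X_pow (i j : ℕ) (u : S) :
    tensorCoeff F S i ((Polynomial.X ^ j : F[X]) ⊗ₜ[F] u) = if i = j then u else 0 := by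
  rw [tensorCoeff_tmul, Polynomial.coeff_X_pow]
  split_ifs <;> simp

theorem X_pow_tmul_injective (i : ℕ) :
    Function.Injective (TensorProduct.mk F F[X] S (Polynomial.X ^ i)) := by
  intro u v h
  have := congrArg (tensorCoeff F S i) h
  simpa [tensorCoeff_X_pow] using this

variable (𝒮 : ZMod N → Submodule F S)

theorem mem_loopComponent {i : ℕ} {x : cyclicLoopAlgebra 𝒮} :
    x ∈ loopComponent 𝒮 i ↔
      ∃ u ∈ 𝒮 (i : ZMod N), (x : F[X] ⊗[F] S) = (Polynomial.X ^ i : F[X]) ⊗ₜ[F] u := by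
  simp only [loopComponent, Submodule.mem_comap, Submodule.mem_map, TensorProduct.mk_apply]
  exact ⟨fun ⟨u, hu, h⟩ => ⟨u, hu, h.symm⟩, fun ⟨u, hu, h⟩ => ⟨u, hu, h.symm⟩⟩

/-- Each nonzero `u ∈ S_i` satisfies `[u, S_1] = S_{i+1}`, in a graded Lie algebra with nonzero
components. -/
structure IsCyclicallyCovered : Prop where
  bracket_mem : ∀ {i j : ZMod N} {u v : S}, u ∈ 𝒮 i → v ∈ 𝒮 j → ⁅u, v⁆ ∈ 𝒮 (i + j)
  covering : ∀ (i : ZMod N), ∀ u ∈ 𝒮 i, u ≠ 0 → ∀ w ∈ 𝒮 (i + 1), ∃ z ∈ 𝒮 1, ⁅u, z⁆ = w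
  ne_bot : ∀ i, 𝒮 i ≠ ⊥

/-- The sum of the `T ^ i ⊗ S_i` over the positive integers `i`. -/
def positiveLoops : Submodule F (F[X] ⊗[F] S) :=
  ⨆ i : ℕ, (𝒮 ((i + 1 : ℕ) : ZMod N)).map (TensorProduct.mk F F[X] S (Polynomial.X ^ (i + 1)))

variable {𝒮}

theorem tmul_mem_positiveLoops {i : ℕ} (hi : 1 ≤ i) {u : S} (hu : u ∈ 𝒮 (i : ZMod N)) :
    (Polynomial.X ^ i : F[X]) ⊗ₜ[F] u ∈ positiveLoops 𝒮 := by
  obtain ⟨k, rfl⟩ : ∃ k, i = k + 1 := ⟨i - 1, by omega⟩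
  exact Submodule.mem_iSup_of_mem k ⟨u, hu, rfl⟩

theorem tensorCoeff_zero_of_mem_positiveLoops {x : F[X] ⊗[F] S} (hx : x ∈ positiveLoops 𝒮) :
    tensorCoeff F S 0 x = 0 := by
  have : positiveLoops 𝒮 ≤ LinearMap.ker (tensorCoeff F S 0) := by
    refine iSup_le fun i => ?_
    rintro _ ⟨u, -, rfl⟩
    simp [tensorCoeff_X_pow]
  exact this hx

namespace IsCyclicallyCovered

variable (H : IsCyclicallyCovered 𝒮)
include H

theorem lie_mem_positiveLoops {x y : F[X] ⊗[F] S} (hx : x ∈ positiveLoops 𝒮)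
    (hy : y ∈ positiveLoops 𝒮) : ⁅x, y⁆ ∈ positiveLoops 𝒮 := by
  refine Submodule.iSup_induction _ (motive := fun x => ⁅x, y⁆ ∈ positiveLoops 𝒮) hx ?_ ?_ ?_
  · rintro i _ ⟨u, hu, rfl⟩
    refine Submodule.iSup_induction _ (motive := fun y => ⁅_, y⁆ ∈ positiveLoops 𝒮) hy ?_ ?_ ?_
    · rintro j _ ⟨v, hv, rfl⟩
      simp only [TensorProduct.mk_apply, LieAlgebra.ExtendScalars.bracket_tmul, ← pow_add]
      refine tmul_mem_positiveLoops (by omega) ?_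
      rw [Nat.cast_add]
      exact H.bracket_mem hu hv
    · exact (lie_zero (L := F[X] ⊗[F] S) (M := F[X] ⊗[F] S) _).symm ▸ zero_mem _
    · intro a b ha hb
      exact (congrArg (· ∈ positiveLoops 𝒮)
        (lie_add (L := F[X] ⊗[F] S) (M := F[X] ⊗[F] S) _ a b)).mpr (add_mem ha hb)
  · exact (zero_lie (L := F[X] ⊗[F] S) y).symm ▸ zero_mem _
  · intro a b ha hb
    exact (add_lie (L := F[X] ⊗[F] S) a b y).symm ▸ add_mem ha hb

/-- Covering from any nonzero element of `S_i` reaches all of `S_{i+1}` in one bracket with `S_1`,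
so generation in degree one misses nothing in positive degrees. -/
theorem tmul_mem_cyclicLoopAlgebra {i : ℕ} (hi : 1 ≤ i) {u : S} (hu : u ∈ 𝒮 (i : ZMod N)) :
    (Polynomial.X ^ i : F[X]) ⊗ₜ[F] u ∈ cyclicLoopAlgebra 𝒮 := by
  induction i, hi using Nat.le_induction generalizing u with
  | base =>
    refine LieSubalgebra.subset_lieSpan ⟨u, by simpa using hu, by rw [pow_one]⟩
  | succ i hi ih =>
    obtain ⟨u₀, h₀, hne⟩ := (Submodule.ne_bot_iff _).1 (H.ne_bot (i : ZMod N))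
    obtain ⟨z, hz, rfl⟩ := H.covering _ u₀ h₀ hne u (by simpa using hu)
    rw [pow_succ, ← LieAlgebra.ExtendScalars.bracket_tmul]
    exact LieSubalgebra.lie_mem _ (ih h₀) (LieSubalgebra.subset_lieSpan ⟨z, hz, rfl⟩)

theorem mem_positiveLoops {x : F[X] ⊗[F] S} (hx : x ∈ cyclicLoopAlgebra 𝒮) :
    x ∈ positiveLoops 𝒮 := by
  induction hx using LieSubalgebra.lieSpan_induction with
  | mem x h =>
    obtain ⟨u, hu, rfl⟩ := h
    have := tmul_mem_positiveLoops (𝒮 := 𝒮) le_rfl (u := u) (by simpa using hu)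
    rwa [pow_one] at this
  | zero => exact zero_mem _
  | add _ _ _ _ hu hv => exact add_mem hu hv
  | smul t _ _ hu => exact Submodule.smul_mem _ _ hu
  | lie _ _ _ _ hu hv => exact H.lie_mem_positiveLoops hu hv

/-- `S_0` itself is nonzero; what vanishes is the coefficient of `T^0` on everything generated in
degree one. -/
theorem loopComponent_zero : loopComponent 𝒮 0 = ⊥ := by
  rw [eq_bot_iff]
  intro x hx
  obtain ⟨u, -, h⟩ := (mem_loopComponent 𝒮).1 hx
  have h0 := tensorCoeff_zero_of_mem_positiveLoops (H.mem_positiveLoops x.2)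
  rw [h, tensorCoeff_X_pow, if_pos rfl] at h0
  rw [Submodule.mem_bot]
  ext1
  rw [h, h0, TensorProduct.tmul_zero, ZeroMemClass.coe_zero]

theorem finrank_loopComponent {i : ℕ} (hi : 1 ≤ i) :
    Module.finrank F (loopComponent 𝒮 i) = Module.finrank F (𝒮 (i : ZMod N)) := by
  have hle : (𝒮 (i : ZMod N)).map (TensorProduct.mk F F[X] S (Polynomial.X ^ i))
      ≤ (cyclicLoopAlgebra 𝒮).toSubmodule := by
    rintro _ ⟨u, hu, rfl⟩
    exact H.tmul_mem_cyclicLoopAlgebra hi hu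
  rw [loopComponent]
  erw [(Submodule.comapSubtypeEquivOfLe hle).finrank_eq]
  exact (Submodule.equivMapOfInjective _ (X_pow_tmul_injective i) _).finrank_eq.symm

theorem loopComponent_ne_bot {i : ℕ} (hi : 1 ≤ i) : loopComponent 𝒮 i ≠ ⊥ := by
  obtain ⟨u, hu, hne⟩ := (Submodule.ne_bot_iff _).1 (H.ne_bot (i : ZMod N))
  refine (Submodule.ne_bot_iff _).2 ⟨⟨_, H.tmul_mem_cyclicLoopAlgebra hi hu⟩,
    (mem_loopComponent 𝒮).2 ⟨u, hu, rfl⟩, fun h => hne ?_⟩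
  have := congrArg (fun x : cyclicLoopAlgebra 𝒮 => tensorCoeff F S i x.1) h
  simpa [tensorCoeff_X_pow] using this

-- The coefficient of `T^i` kills all components but the `i`-th, on which it is injective.
omit H in
theorem iSupIndep_loopComponent : iSupIndep (loopComponent 𝒮) := by
  intro i
  rw [disjoint_iff, eq_bot_iff]
  rintro x ⟨hx, hx'⟩
  obtain ⟨u, -, h⟩ := (mem_loopComponent 𝒮).1 hx
  have hker : (⨆ j, ⨆ (_ : j ≠ i), loopComponent 𝒮 j) ≤
      LinearMap.ker (tensorCoeff F S i ∘ₗ (cyclicLoopAlgebra 𝒮).toSubmodule.subtype) := by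
    refine iSup₂_le fun j hj y hy => ?_
    obtain ⟨v, -, hv⟩ := (mem_loopComponent 𝒮).1 hy
    rw [LinearMap.mem_ker, LinearMap.comp_apply, Submodule.subtype_apply]
    erw [hv]
    rw [tensorCoeff_X_pow, if_neg hj.symm]
  have h0 : tensorCoeff F S i (x : F[X] ⊗[F] S) = 0 := hker hx'
  rw [h, tensorCoeff_X_pow, if_pos rfl] at h0
  rw [Submodule.mem_bot]
  ext1
  rw [h, h0, TensorProduct.tmul_zero, ZeroMemClass.coe_zero]

theorem iSup_loopComponent : ⨆ i, loopComponent 𝒮 i = ⊤ := by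
  have hle : positiveLoops 𝒮 ≤
      (⨆ i, loopComponent 𝒮 i).map (cyclicLoopAlgebra 𝒮).toSubmodule.subtype := by
    refine iSup_le fun i => ?_
    rintro _ ⟨u, hu, rfl⟩
    exact ⟨⟨_, H.tmul_mem_cyclicLoopAlgebra (by omega) hu⟩,
      Submodule.mem_iSup_of_mem (i + 1) ((mem_loopComponent 𝒮).2 ⟨u, hu, rfl⟩), rfl⟩
  rw [eq_top_iff]
  intro x _
  obtain ⟨y, hy, hxy⟩ := hle (H.mem_positiveLoops x.2)
  rwa [show x = y from Subtype.ext hxy.symm]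

theorem nonempty_gradedLieAlgebra : Nonempty (GradedLieAlgebra (loopComponent 𝒮)) := by
  have hint : DirectSum.IsInternal (loopComponent 𝒮) :=
    (DirectSum.isInternal_submodule_iff_iSupIndep_and_iSup_eq_top _).2
      ⟨iSupIndep_loopComponent, H.iSup_loopComponent⟩
  refine ⟨{ hint.chooseDecomposition with bracket_mem := ?_ }⟩
  intro i j x y hx hy
  obtain ⟨u, hu, hxu⟩ := (mem_loopComponent 𝒮).1 hx
  obtain ⟨v, hv, hyv⟩ := (mem_loopComponent 𝒮).1 hy
  refine (mem_loopComponent 𝒮).2 ⟨⁅u, v⁆, ?_, ?_⟩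
  · rw [Nat.cast_add]
    exact H.bracket_mem hu hv
  · rw [LieSubalgebra.coe_bracket, hxu, hyv, LieAlgebra.ExtendScalars.bracket_tmul, ← pow_add]

/-- An independent family of submodules of a finite-dimensional space has only finitely many nonzero
members. -/
theorem not_finiteDimensional : ¬ FiniteDimensional F (cyclicLoopAlgebra 𝒮) := by
  intro hfin
  have := WellFoundedGT.finite_ne_bot_of_iSupIndep
    (iSupIndep_loopComponent (𝒮 := 𝒮))
  exact (Set.Ici_infinite 1).mono (fun i hi => H.loopComponent_ne_bot hi) this

theorem isThin (h1 : Module.finrank F (𝒮 1) = 2)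
    (hd : ∃ i : ℕ, 1 < i ∧ Module.finrank F (𝒮 (i : ZMod N)) = 2) :
    IsThin (loopComponent 𝒮) where
  graded := H.nonempty_gradedLieAlgebra
  zero := H.loopComponent_zero
  finrank_one := by rw [H.finrank_loopComponent le_rfl, Nat.cast_one, h1]
  covering := by
    intro i hi x hx hne
    obtain ⟨u, hu, hxu⟩ := (mem_loopComponent 𝒮).1 hx
    have hune : u ≠ 0 := by
      rintro rfl
      exact hne (Subtype.ext (by rw [hxu, TensorProduct.tmul_zero, ZeroMemClass.coe_zero]))
    ext w
    rw [Submodule.mem_map, mem_loopComponent]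
    constructor
    · rintro ⟨y, hy, rfl⟩
      obtain ⟨v, hv, hyv⟩ := (mem_loopComponent 𝒮).1 hy
      refine ⟨⁅u, v⁆, ?_, ?_⟩
      · rw [Nat.cast_add]
        exact H.bracket_mem hu hv
      · change ((⁅x, y⁆ : cyclicLoopAlgebra 𝒮) : F[X] ⊗[F] S) = _
        rw [LieSubalgebra.coe_bracket, hxu, hyv, LieAlgebra.ExtendScalars.bracket_tmul, ← pow_add]
    · rintro ⟨w', hw', hw⟩
      obtain ⟨z, hz, rfl⟩ := H.covering _ u hu hune w' (by simpa using hw')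
      have hz' : z ∈ 𝒮 ((1 : ℕ) : ZMod N) := by simpa using hz
      refine ⟨⟨_, H.tmul_mem_cyclicLoopAlgebra le_rfl hz'⟩,
        (mem_loopComponent 𝒮).2 ⟨z, hz', rfl⟩, ?_⟩
      ext1
      rw [hw]
      change ((⁅x, _⁆ : cyclicLoopAlgebra 𝒮) : F[X] ⊗[F] S) = _
      rw [LieSubalgebra.coe_bracket, hxu, LieAlgebra.ExtendScalars.bracket_tmul, ← pow_add]
  infinite := H.not_finiteDimensional
  exists_diamond := by
    obtain ⟨i, hi, h⟩ := hd
    exact ⟨i, hi, by rw [H.finrank_loopComponent hi.le, h]⟩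

end IsCyclicallyCovered

end LoopStructure

/-! ### Reduction of identities between homogeneous elements of the loop algebra to `S`. -/

section LoopBrackets

variable {F S : Type*} [Field F] [LieRing S] [LieAlgebra F S] {N : ℕ}
  {𝒮 : ZMod N → Submodule F S}

theorem coe_lie_of_coe_eq {i : ℕ} {V A : cyclicLoopAlgebra 𝒮} {v a : S}
    (hV : (V : F[X] ⊗[F] S) = (Polynomial.X ^ i : F[X]) ⊗ₜ[F] v)
    (hA : (A : F[X] ⊗[F] S) = (Polynomial.X ^ 1 : F[X]) ⊗ₜ[F] a) :
    ((⁅V, A⁆ : cyclicLoopAlgebra 𝒮) : F[X] ⊗[F] S)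
      = (Polynomial.X ^ (i + 1) : F[X]) ⊗ₜ[F] ⁅v, a⁆ := by
  rw [LieSubalgebra.coe_bracket, hV, hA, LieAlgebra.ExtendScalars.bracket_tmul, ← pow_add]

theorem X_pow_tmul_eq_iff {i : ℕ} {u v : S} :
    (Polynomial.X ^ i : F[X]) ⊗ₜ[F] u = (Polynomial.X ^ i : F[X]) ⊗ₜ[F] v ↔ u = v :=
  (X_pow_tmul_injective (F := F) (S := S) i).eq_iff

theorem eq_iff_of_coe_eq {i : ℕ} {V W : cyclicLoopAlgebra 𝒮} {v w : S}
    (hV : (V : F[X] ⊗[F] S) = (Polynomial.X ^ i : F[X]) ⊗ₜ[F] v)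
    (hW : (W : F[X] ⊗[F] S) = (Polynomial.X ^ i : F[X]) ⊗ₜ[F] w) : V = W ↔ v = w := by
  rw [Subtype.ext_iff, hV, hW, X_pow_tmul_eq_iff]

theorem coe_smul_of_coe_eq {i : ℕ} (α : F) {V : cyclicLoopAlgebra 𝒮} {v : S}
    (hV : (V : F[X] ⊗[F] S) = (Polynomial.X ^ i : F[X]) ⊗ₜ[F] v) :
    ((α • V : cyclicLoopAlgebra 𝒮) : F[X] ⊗[F] S) = (Polynomial.X ^ i : F[X]) ⊗ₜ[F] (α • v) := by
  rw [TensorProduct.tmul_smul, ← hV]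
  rfl

theorem eq_zero_iff_of_coe_eq {i : ℕ} {V : cyclicLoopAlgebra 𝒮} {v : S}
    (hV : (V : F[X] ⊗[F] S) = (Polynomial.X ^ i : F[X]) ⊗ₜ[F] v) : V = 0 ↔ v = 0 :=
  eq_iff_of_coe_eq (i := i) hV (by rw [TensorProduct.tmul_zero, ZeroMemClass.coe_zero])

end LoopBrackets

/-! ### Diamond tables: covering, thinness and the location of the diamonds. -/

/-- The residue class of `(q - 1) t + 1 - m`. -/
def tableDeg (N q : ℕ) (t : ℤ) (m : ℕ) : ZMod N := ((((q : ℤ) - 1) * t + 1 - m : ℤ) : ZMod N)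

/-- The hypothesis is `i = (q - 1) t + 1 - m` freed of natural-number subtraction. -/
theorem tableDeg_eq_natCast {N q t m i : ℕ} (h : i + m + t = q * t + 1) :
    tableDeg N q t m = (i : ZMod N) := by
  rw [tableDeg, ← Int.cast_natCast i]
  congr 1
  have : (i : ℤ) + m + t = q * t + 1 := by exact_mod_cast h
  linarith

theorem tableDeg_zero_zero (N q : ℕ) : tableDeg N q 0 0 = 1 := by
  simp [tableDeg]

theorem tableDeg_zero_add_one {N q : ℕ} (hq : 2 ≤ q) (t : ℤ) :
    tableDeg N q t 0 + 1 = tableDeg N q (t + 1) (q - 2) := by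
  simp only [tableDeg]
  push_cast [hq]
  ring

theorem tableDeg_succ_add_one (N q : ℕ) (t : ℤ) (m : ℕ) :
    tableDeg N q t (m + 1) + 1 = tableDeg N q t m := by
  simp only [tableDeg]
  push_cast
  ring

/-- A cyclically graded Lie algebra with elements `v m t`, for `0 ≤ m < q` and `t` an integer, of
degree `(q - 1) t + 1 - m`, that span the components, such that `ad (v 0 0)` lowers `m` by `1` and
`ad (v (q - 1) 1)` acts nontrivially only in degrees `(q - 1) t` and `(q - 1) t + 1`. -/
structure IsDiamondTable {F S : Type*} [Field F] [LieRing S] [LieAlgebra F S] {N : ℕ}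
    (𝒮 : ZMod N → Submodule F S) (q : ℕ) (v : ℕ → ℤ → S) (c d : ℤ → F) : Prop where
  three_le : 3 ≤ q
  bracket_mem : ∀ {i j : ZMod N} {u w : S}, u ∈ 𝒮 i → w ∈ 𝒮 j → ⁅u, w⁆ ∈ 𝒮 (i + j)
  component : ∀ t m, 1 ≤ m → m + 1 < q → 𝒮 (tableDeg N q t m) = Submodule.span F {v m t}
  diamond : ∀ t, 𝒮 (tableDeg N q t 0) = Submodule.span F {v 0 t, v (q - 1) (t + 1)}
  ne_zero : ∀ t m, 1 ≤ m → m + 1 < q → v m t ≠ 0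
  linearIndependent : ∀ t, LinearIndependent F ![v 0 t, v (q - 1) (t + 1)]
  lie_X : ∀ t m, m + 1 < q → ⁅v (m + 1) t, v 0 0⁆ = v m t
  lie_X_zero : ∀ t, ⁅v 0 t, v 0 0⁆ = 0
  lie_Y : ∀ t m, 2 ≤ m → m < q → ⁅v m t, v (q - 1) 1⁆ = 0
  lie_Y_one : ∀ t, ⁅v 1 t, v (q - 1) 1⁆ = d t • v (q - 1) (t + 1)
  lie_Y_zero : ∀ t, ⁅v 0 t, v (q - 1) 1⁆ = c t • v (q - 2) (t + 1)
  c_ne : ∀ t, c t ≠ 0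
  d_ne : ∀ t, d t ≠ 0

namespace IsDiamondTable

variable {F S : Type*} [Field F] [LieRing S] [LieAlgebra F S] {N : ℕ}
  {𝒮 : ZMod N → Submodule F S} {q : ℕ} {v : ℕ → ℤ → S} {c d : ℤ → F}

theorem exists_tableDeg (hq : 3 ≤ q) (x : ZMod N) :
    ∃ t : ℤ, ∃ m : ℕ, m + 1 < q ∧ x = tableDeg N q t m := by
  obtain ⟨D, rfl⟩ := ZMod.intCast_surjective x
  have hpos : 0 < (q : ℤ) - 1 := by omega
  have h1 := Int.emod_nonneg (1 - D) hpos.ne'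
  have h2 := Int.emod_lt_of_pos (1 - D) hpos
  have h3 := Int.mul_ediv_add_emod (1 - D) ((q : ℤ) - 1)
  -- `D = (q-1)t + 1 - m` reads `1 - D = (q-1)(-t) + m`, a division with remainder. The remainder
  -- omits `m = q - 1`, whose degree is already that of `m = 0` with `t` lowered by one.
  refine ⟨-((1 - D) / ((q : ℤ) - 1)), ((1 - D) % ((q : ℤ) - 1)).toNat, by omega, ?_⟩
  rw [tableDeg, Int.toNat_of_nonneg h1]
  congr 1
  linarith

variable (H : IsDiamondTable 𝒮 q v c d)
include H

theorem X_mem : v 0 0 ∈ 𝒮 1 := by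
  have := H.diamond 0
  rw [tableDeg_zero_zero] at this
  rw [this]
  exact Submodule.subset_span (by simp)

theorem Y_mem : v (q - 1) 1 ∈ 𝒮 1 := by
  have := H.diamond 0
  rw [tableDeg_zero_zero] at this
  rw [this]
  exact Submodule.subset_span (by simp)

theorem lie_X_top (t : ℤ) : ⁅v (q - 1) t, v 0 0⁆ = v (q - 2) t := by
  have hq := H.three_le
  have := H.lie_X t (q - 2) (by omega)
  rwa [show q - 2 + 1 = q - 1 by omega] at this

theorem mem_degree_one {z : S} (hz : z ∈ 𝒮 1) : ∃ a b : F, z = a • v 0 0 + b • v (q - 1) 1 := by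
  have := H.diamond 0
  rw [tableDeg_zero_zero] at this
  rw [this, Submodule.mem_span_pair] at hz
  obtain ⟨a, b, rfl⟩ := hz
  exact ⟨a, b, by simp⟩

theorem finrank_diamond (t : ℤ) : Module.finrank F (𝒮 (tableDeg N q t 0)) = 2 := by
  have := finrank_span_eq_card (H.linearIndependent t)
  rw [H.diamond]
  rwa [Matrix.range_cons_cons_empty, Fintype.card_fin] at this

theorem finrank_component (t : ℤ) {m : ℕ} (h1 : 1 ≤ m) (h2 : m + 1 < q) :
    Module.finrank F (𝒮 (tableDeg N q t m)) = 1 := by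
  rw [H.component t m h1 h2]
  exact finrank_span_singleton (H.ne_zero t m h1 h2)

/-- There are three kinds of degree. Just before a diamond, `X` and `Y` send `v 1 t` to nonzero
multiples of the two basis vectors. Inside a diamond, one generator suffices for each nonzero
vector. Elsewhere `X` alone maps onto the next line. -/
theorem isCyclicallyCovered : IsCyclicallyCovered 𝒮 where
  bracket_mem := H.bracket_mem
  covering := by
    have hq := H.three_le
    intro x u hu hne w hw
    obtain ⟨t, m, hm, rfl⟩ := exists_tableDeg H.three_le x
    have hX := H.X_mem
    have hY := H.Y_mem
    rcases Nat.lt_or_ge m 1 with h | h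
    · obtain rfl : m = 0 := by omega
      rw [tableDeg_zero_add_one (by omega), H.component _ _ (by omega) (by omega), Submodule.mem_span_singleton] at hw
      obtain ⟨γ, rfl⟩ := hw
      rw [H.diamond, Submodule.mem_span_pair] at hu
      obtain ⟨α, β, rfl⟩ := hu
      -- `X` kills `v 0 t` but not `v (q-1) (t+1)`: it works as soon as the latter occurs, and
      -- otherwise `Y` does.
      by_cases hβ : β = 0
      · have hα : α ≠ 0 := by
          rintro rfl
          simp [hβ] at hne
        have hc := H.c_ne t
        refine ⟨(γ / (α * c t)) • v (q - 1) 1, Submodule.smul_mem _ _ hY, ?_⟩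
        rw [hβ, zero_smul, add_zero, lie_smul, smul_lie, H.lie_Y_zero, smul_smul, smul_smul]
        congr 1
        field_simp
      · refine ⟨(γ / β) • v 0 0, Submodule.smul_mem _ _ hX, ?_⟩
        rw [lie_smul, add_lie, smul_lie, smul_lie, H.lie_X_zero, H.lie_X_top, smul_zero, zero_add,
          smul_smul]
        congr 1
        field_simp
    · have hd := tableDeg_succ_add_one N q t (m - 1)
      rw [Nat.sub_add_cancel h] at hd
      rw [H.component _ _ h hm, Submodule.mem_span_singleton] at hu
      obtain ⟨α, rfl⟩ := hu
      have hα : α ≠ 0 := by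
        rintro rfl
        simp at hne
      have hlX := H.lie_X t (m - 1) (by omega)
      rw [Nat.sub_add_cancel h] at hlX
      rw [hd] at hw
      rcases Nat.lt_or_ge m 2 with h' | h'
      · obtain rfl : m = 1 := by omega
        have hdn := H.d_ne t
        rw [Nat.sub_self, H.diamond, Submodule.mem_span_pair] at hw
        obtain ⟨γ, δ, rfl⟩ := hw
        refine ⟨(γ / α) • v 0 0 + (δ / (α * d t)) • v (q - 1) 1,
          add_mem (Submodule.smul_mem _ _ hX) (Submodule.smul_mem _ _ hY), ?_⟩
        rw [lie_add, lie_smul, lie_smul, smul_lie, smul_lie, hlX, H.lie_Y_one, smul_smul,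
          smul_smul, smul_smul]
        congr 2 <;> field_simp
      · rw [H.component _ _ (by omega) (by omega), Submodule.mem_span_singleton] at hw
        obtain ⟨γ, rfl⟩ := hw
        refine ⟨(γ / α) • v 0 0, Submodule.smul_mem _ _ hX, ?_⟩
        rw [lie_smul, smul_lie, hlX, smul_smul]
        congr 1
        field_simp
  ne_bot := by
    intro x hx
    obtain ⟨t, m, hm, rfl⟩ := exists_tableDeg H.three_le x
    have h0 : Module.finrank F (𝒮 (tableDeg N q t m)) = 0 := by rw [hx, finrank_bot]
    rcases Nat.eq_zero_or_pos m with rfl | h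
    · rw [H.finrank_diamond] at h0
      omega
    · rw [H.finrank_component t h hm] at h0
      omega

theorem finrank_loopComponent_diamond (t : ℕ) :
    Module.finrank F (loopComponent 𝒮 (t * (q - 1) + 1)) = 2 := by
  have hq := H.three_le
  rw [H.isCyclicallyCovered.finrank_loopComponent (by omega),
    ← tableDeg_eq_natCast (q := q) (t := t) (m := 0), H.finrank_diamond]
  obtain ⟨k, rfl⟩ : ∃ k, q = k + 1 := ⟨q - 1, by omega⟩
  simp only [Nat.add_sub_cancel]
  ring

theorem isDiamond_iff (i : ℕ) :
    IsDiamond (loopComponent 𝒮) i ↔ ∃ t : ℕ, i = t * (q - 1) + 1 := by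
  have hq := H.three_le
  constructor
  · intro h
    rw [IsDiamond] at h
    rcases Nat.eq_zero_or_pos i with rfl | hi
    · rw [H.isCyclicallyCovered.loopComponent_zero, finrank_bot] at h
      omega
    · obtain ⟨k, rfl⟩ : ∃ k, q = k + 1 := ⟨q - 1, by omega⟩
      obtain ⟨j, rfl⟩ : ∃ j, i = j + 1 := ⟨i - 1, by omega⟩
      simp only [Nat.add_sub_cancel]
      by_cases hr : j % k = 0
      · exact ⟨j / k, by rw [mul_comm, Nat.mul_div_cancel' (Nat.dvd_of_mod_eq_zero hr)]⟩
      · have h1 := Nat.mod_lt j (show 0 < k by omega)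
        have h2 := Nat.div_add_mod j k
        -- With `k = q - 1` and `r = j % k > 0`, the degree is `j + 1 = k (j / k + 1) + 1 - (k -
        -- r)`, so `m = k - r` lies strictly between `0` and `q - 1`.
        rw [H.isCyclicallyCovered.finrank_loopComponent (by omega),
          ← tableDeg_eq_natCast (q := k + 1) (t := j / k + 1) (m := k - j % k),
          H.finrank_component _ (by omega) (by omega)] at h
        · omega
        · have h3 : (k + 1) * (j / k + 1) = k * (j / k) + k + (j / k + 1) := by ring
          omega
  · rintro ⟨t, rfl⟩
    exact H.finrank_loopComponent_diamond t

theorem isThin : IsThin (loopComponent 𝒮) := by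
  have hq := H.three_le
  refine H.isCyclicallyCovered.isThin ?_ ⟨q, by omega, ?_⟩
  · have := H.finrank_diamond 0
    rwa [tableDeg_zero_zero] at this
  · have := H.finrank_loopComponent_diamond 1
    rwa [one_mul, Nat.sub_add_cancel (by omega),
      H.isCyclicallyCovered.finrank_loopComponent (by omega)] at this

theorem secondDiamondAt : SecondDiamondAt (loopComponent 𝒮) q := by
  have hq := H.three_le
  refine ⟨by omega, (H.isDiamond_iff q).2 ⟨1, by omega⟩, fun i h1 h2 h => ?_⟩
  obtain ⟨t, rfl⟩ := (H.isDiamond_iff i).1 h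
  rcases t with _ | t
  · simp at h1
  · have : (t + 1) * (q - 1) = t * (q - 1) + (q - 1) := by ring
    have : 0 ≤ t * (q - 1) := Nat.zero_le _
    omega

theorem mem_loopComponent_pred_diamond (t : ℕ) {V : cyclicLoopAlgebra 𝒮} :
    V ∈ loopComponent 𝒮 (t * (q - 1)) ↔ ∃ γ : F, (V : F[X] ⊗[F] S) =
      (Polynomial.X ^ (t * (q - 1)) : F[X]) ⊗ₜ[F] (γ • v 1 t) := by
  have hq := H.three_le
  have hd : tableDeg N q t 1 = ((t * (q - 1) : ℕ) : ZMod N) := by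
    refine tableDeg_eq_natCast ?_
    obtain ⟨k, rfl⟩ : ∃ k, q = k + 1 := ⟨q - 1, by omega⟩
    simp only [Nat.add_sub_cancel]
    ring
  rw [mem_loopComponent, ← hd, H.component _ _ le_rfl (by omega)]
  simp only [Submodule.mem_span_singleton]
  constructor
  · rintro ⟨_, ⟨γ, rfl⟩, h⟩
    exact ⟨γ, h⟩
  · rintro ⟨γ, h⟩
    exact ⟨_, ⟨γ, rfl⟩, h⟩

theorem exists_mem_loopComponent_pred_diamond {t : ℕ} (ht : 1 ≤ t) :
    ∃ V ∈ loopComponent 𝒮 (t * (q - 1)), (V : F[X] ⊗[F] S) =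
      (Polynomial.X ^ (t * (q - 1)) : F[X]) ⊗ₜ[F] v 1 t := by
  have hq := H.three_le
  have hpos : 1 ≤ t * (q - 1) := Nat.one_le_iff_ne_zero.2 (Nat.mul_ne_zero (by omega) (by omega))
  have hd : tableDeg N q t 1 = ((t * (q - 1) : ℕ) : ZMod N) := by
    refine tableDeg_eq_natCast ?_
    obtain ⟨k, rfl⟩ : ∃ k, q = k + 1 := ⟨q - 1, by omega⟩
    simp only [Nat.add_sub_cancel]
    ring
  have hv : v 1 t ∈ 𝒮 ((t * (q - 1) : ℕ) : ZMod N) := by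
    rw [← hd, H.component _ _ le_rfl (by omega)]
    exact Submodule.mem_span_singleton_self _
  exact ⟨⟨_, H.isCyclicallyCovered.tmul_mem_cyclicLoopAlgebra hpos hv⟩,
    (mem_loopComponent 𝒮).2 ⟨_, hv, rfl⟩, rfl⟩

end IsDiamondTable

/-! ### Diamond types and standard generators of a diamond table. -/

namespace IsDiamondTable

variable {F S : Type*} [Field F] [LieRing S] [LieAlgebra F S] {N : ℕ}
  {𝒮 : ZMod N → Submodule F S} {q : ℕ} {v : ℕ → ℤ → S} {c d : ℤ → F}
  (H : IsDiamondTable 𝒮 q v c d)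
include H

theorem v_ne_zero (t : ℤ) : v (q - 2) t ≠ 0 :=
  H.ne_zero t (q - 2) (by have := H.three_le; omega) (by have := H.three_le; omega)

theorem lie_XX_one (t : ℤ) : ⁅⁅v 1 t, v 0 0⁆, v 0 0⁆ = 0 := by
  have hq := H.three_le
  have := H.lie_X t 0 (by omega)
  rw [zero_add] at this
  rw [this, H.lie_X_zero]

theorem lie_XY_one (t : ℤ) : ⁅⁅v 1 t, v 0 0⁆, v (q - 1) 1⁆ = c t • v (q - 2) (t + 1) := by
  have hq := H.three_le
  have := H.lie_X t 0 (by omega)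
  rw [zero_add] at this
  rw [this, H.lie_Y_zero]

theorem lie_YX_one (t : ℤ) : ⁅⁅v 1 t, v (q - 1) 1⁆, v 0 0⁆ = d t • v (q - 2) (t + 1) := by
  rw [H.lie_Y_one, smul_lie, H.lie_X_top]

theorem lie_YY_one (t : ℤ) : ⁅⁅v 1 t, v (q - 1) 1⁆, v (q - 1) 1⁆ = 0 := by
  have hq := H.three_le
  rw [H.lie_Y_one, smul_lie, H.lie_Y _ _ (by omega) (by omega), smul_zero]

variable {a b : F} (ha : a ≠ 0) (hb : b ≠ 0) {X Y : cyclicLoopAlgebra 𝒮}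
  (hX : (X : F[X] ⊗[F] S) = (Polynomial.X ^ 1 : F[X]) ⊗ₜ[F] (a • v 0 0))
  (hY : (Y : F[X] ⊗[F] S) = (Polynomial.X ^ 1 : F[X]) ⊗ₜ[F] (b • v (q - 1) 1))
include hX hY

/-- The double brackets of the elements of the component before a diamond with the generators. -/
theorem lie_lie_of_mem {t : ℕ} {V : cyclicLoopAlgebra 𝒮}
    (hV : V ∈ loopComponent 𝒮 (t * (q - 1))) :
    ⁅⁅V, X⁆, X⁆ = 0 ∧ ⁅⁅V, Y⁆, Y⁆ = 0 ∧
      d t • ⁅⁅V, X⁆, Y⁆ = c t • ⁅⁅V, Y⁆, X⁆ := by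
  obtain ⟨γ, hγ⟩ := (H.mem_loopComponent_pred_diamond t).1 hV
  have hVX := coe_lie_of_coe_eq hγ hX
  have hVY := coe_lie_of_coe_eq hγ hY
  refine ⟨(eq_zero_iff_of_coe_eq (coe_lie_of_coe_eq hVX hX)).2 ?_,
    (eq_zero_iff_of_coe_eq (coe_lie_of_coe_eq hVY hY)).2 ?_,
    (eq_iff_of_coe_eq (coe_smul_of_coe_eq _ (coe_lie_of_coe_eq hVX hY))
      (coe_smul_of_coe_eq _ (coe_lie_of_coe_eq hVY hX))).2 ?_⟩
  · simp only [smul_lie, lie_smul, H.lie_XX_one, smul_zero]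
  · simp only [smul_lie, lie_smul, H.lie_YY_one, smul_zero]
  · simp only [smul_lie, lie_smul, H.lie_XY_one, H.lie_YX_one, smul_smul]
    congr 1
    ring

include ha hb

/-- One nonzero vector measures both double brackets, which turns the relations defining a type into
scalar equations. Here `W` is `a b v (q-2) (t+1)` times a power of `T`. -/
theorem exists_lie_lie {t : ℕ} (ht : 1 ≤ t) :
    ∃ V ∈ loopComponent 𝒮 (t * (q - 1)), ∃ W : cyclicLoopAlgebra 𝒮, W ≠ 0 ∧
      ⁅⁅V, X⁆, Y⁆ = c t • W ∧ ⁅⁅V, Y⁆, X⁆ = d t • W := by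
  obtain ⟨V, hV, hVe⟩ := H.exists_mem_loopComponent_pred_diamond ht
  have hXY := coe_lie_of_coe_eq (coe_lie_of_coe_eq hVe hX) hY
  have hYX := coe_lie_of_coe_eq (coe_lie_of_coe_eq hVe hY) hX
  simp only [smul_lie, lie_smul, H.lie_XY_one, H.lie_YX_one, smul_smul] at hXY hYX
  have hc := H.c_ne t
  have hW := coe_smul_of_coe_eq (c t)⁻¹ hXY
  refine ⟨V, hV, (c t)⁻¹ • ⁅⁅V, X⁆, Y⁆, fun h => ?_, ?_, ?_⟩
  · rw [eq_zero_iff_of_coe_eq hW, smul_smul] at h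
    refine smul_ne_zero ?_ (H.v_ne_zero _) h
    simp [ha, hb, hc]
  · rw [smul_smul, mul_inv_cancel₀ hc, one_smul]
  · rw [eq_iff_of_coe_eq hYX (coe_smul_of_coe_eq _ hW), smul_smul, smul_smul]
    congr 1
    field_simp

/-- Rescaling the generators multiplies both double brackets by `a b`, so only the ratio of `c t`
and `d t` matters. -/
theorem hasDiamondType_iff {t : ℕ} (ht : 1 ≤ t) (τ : OnePoint F) :
    HasDiamondType (loopComponent 𝒮) X Y (t * (q - 1) + 1) τ ↔
      (∀ μ : F, τ = (μ : OnePoint F) → (1 - μ) * c t = μ * d t) ∧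
      (τ = OnePoint.infty → -c t = d t) := by
  have hq := H.three_le
  have hpos : 1 ≤ t * (q - 1) := Nat.one_le_iff_ne_zero.2 (Nat.mul_ne_zero (by omega) (by omega))
  constructor
  · intro h
    obtain ⟨V, hV, W, hW, h1, h2⟩ := H.exists_lie_lie ha hb hX hY ht
    refine ⟨fun μ hμ => ?_, fun hτ => ?_⟩
    · have := h.finite μ hμ V (by simpa using hV)
      rw [h1, h2, smul_smul, smul_smul] at this
      exact smul_left_injective F hW this
    · have := h.infinite hτ V (by simpa using hV)
      rw [h1, h2, ← neg_smul] at this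
      exact smul_left_injective F hW this
  · rintro ⟨h1, h2⟩
    have hd := H.d_ne t
    have key : ∀ V ∈ loopComponent 𝒮 (t * (q - 1) + 1 - 1),
        ⁅⁅V, X⁆, Y⁆ = (c t / d t) • ⁅⁅V, Y⁆, X⁆ := by
      intro V hV
      have h3 := (H.lie_lie_of_mem hX hY (by simpa using hV)).2.2
      rw [div_eq_inv_mul, ← smul_smul, ← h3, smul_smul, inv_mul_cancel₀ hd, one_smul]
    refine ⟨by omega, H.finrank_loopComponent_diamond t, ?_, ?_, ?_, ?_, ?_⟩
    · rw [Nat.add_sub_cancel, H.isCyclicallyCovered.finrank_loopComponent hpos,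
        ← tableDeg_eq_natCast (q := q) (t := t) (m := 1), H.finrank_component _ le_rfl (by omega)]
      obtain ⟨k, rfl⟩ : ∃ k, q = k + 1 := ⟨q - 1, by omega⟩
      simp only [Nat.add_sub_cancel]
      ring
    · intro V hV
      exact (H.lie_lie_of_mem hX hY (by simpa using hV)).2.1
    · intro V hV
      exact (H.lie_lie_of_mem hX hY (by simpa using hV)).1
    · intro μ hμ V hV
      rw [key V hV, smul_smul, mul_div_assoc', h1 μ hμ, mul_div_cancel_right₀ _ hd]
    · intro hτ V hV
      rw [key V hV, ← neg_smul, ← neg_div, h2 hτ, div_self hd, one_smul]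

/-- The type is `c / (c + d)`, or infinite if `c + d = 0`; since `c ≠ 0`, a finite type is
impossible in the latter case. -/
theorem existsUnique_hasDiamondType {t : ℕ} (ht : 1 ≤ t) :
    ∃! τ : OnePoint F, HasDiamondType (loopComponent 𝒮) X Y (t * (q - 1) + 1) τ := by
  simp only [H.hasDiamondType_iff ha hb hX hY ht]
  have hc := H.c_ne t
  by_cases h : c t + d t = 0
  · refine ⟨OnePoint.infty, ⟨fun μ hμ => (OnePoint.infty_ne_coe μ hμ).elim,
      fun _ => by linear_combination -h⟩, ?_⟩
    rintro τ ⟨h1, -⟩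
    by_contra hτ
    obtain ⟨μ, rfl⟩ := OnePoint.ne_infty_iff_exists.1 hτ
    exact hc (by linear_combination h1 μ rfl + μ * h)
  · refine ⟨((c t / (c t + d t) : F) : OnePoint F), ⟨fun μ hμ => ?_,
      fun hμ => (OnePoint.coe_ne_infty _ hμ).elim⟩, ?_⟩
    · rw [← OnePoint.coe_injective hμ]
      field_simp
      ring
    · rintro τ ⟨h1, h2⟩
      by_cases hτ : τ = OnePoint.infty
      · exact (h (by linear_combination -h2 hτ)).elim
      · obtain ⟨μ, rfl⟩ := OnePoint.ne_infty_iff_exists.1 hτ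
        congr 1
        rw [eq_div_iff h]
        linear_combination -h1 μ rfl

theorem hasDiamondPattern {r : ℕ} {δ : F} (hinf : ∀ t : ℕ, ¬ t ≡ 1 [MOD r] → c t + d t = 0)
    (hfin : ∀ m : ℕ, c ((m * r + 1 : ℕ) : ℤ)
      = (-1 + m * δ) * (c ((m * r + 1 : ℕ) : ℤ) + d ((m * r + 1 : ℕ) : ℤ)))
    (hδ : δ ∉ (⊥ : Subfield F)) :
    HasDiamondPattern (loopComponent 𝒮) X Y q r (-1 + δ) := by
  have key : ∀ m : ℕ, HasDiamondType (loopComponent 𝒮) X Y ((q - 1) * (m * r + 1) + 1)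
      ((-1 + m * δ : F) : OnePoint F) := by
    intro m
    rw [mul_comm, H.hasDiamondType_iff ha hb hX hY (by omega)]
    refine ⟨fun μ hμ => ?_, fun h => (OnePoint.coe_ne_infty _ h).elim⟩
    rw [← OnePoint.coe_injective hμ]
    linear_combination hfin m
  refine ⟨fun t ht => H.existsUnique_hasDiamondType ha hb hX hY ht, ?_,
    ⟨fun m => -1 + m * δ, key, ⟨δ, fun m => by push_cast; ring⟩, 1, ?_⟩, ?_⟩
  · intro t ht τ hτ
    have h2 := (H.hasDiamondType_iff ha hb hX hY ht τ).1 hτ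
    constructor
    · intro hne
      by_contra hmod
      obtain ⟨μ, rfl⟩ := OnePoint.ne_infty_iff_exists.1 hne
      exact H.c_ne t (by linear_combination h2.1 μ rfl + μ * hinf t hmod)
    · rintro hmod rfl
      obtain ⟨m, hm⟩ := (Nat.modEq_iff_dvd' ht).1 hmod.symm
      obtain rfl : t = m * r + 1 := by
        rw [mul_comm] at hm
        omega
      apply H.c_ne ((m * r + 1 : ℕ) : ℤ)
      -- Infinite type means `c + d = 0`, and then `hfin` forces `c = 0`.
      linear_combination hfin m - (-1 + m * δ) * h2.2 rfl
  · intro h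
    apply hδ
    have := add_mem h (one_mem (⊥ : Subfield F))
    simpa using this
  · have := key 1
    simpa using this

theorem isNottinghamPair (h1 : d 1 = -2 * c 1) : IsNottinghamPair (loopComponent 𝒮) q X Y := by
  have hq := H.three_le
  have hmem : ∀ V ∈ loopComponent 𝒮 (q - 1), V ∈ loopComponent 𝒮 (1 * (q - 1)) := by
    intro V hV
    rwa [one_mul]
  refine ⟨?_, ?_, ?_, ?_, ?_, ?_, ?_⟩
  · exact (mem_loopComponent 𝒮).2 ⟨_, Submodule.smul_mem _ _ (by simpa using H.X_mem), hX⟩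
  · exact (mem_loopComponent 𝒮).2 ⟨_, Submodule.smul_mem _ _ (by simpa using H.Y_mem), hY⟩
  · rw [LinearIndependent.pair_iff]
    intro α β h
    have hli := H.linearIndependent 0
    rw [LinearIndependent.pair_iff] at hli
    have h0 : (α * a) • v 0 0 + (β * b) • v (q - 1) (0 + 1) = 0 := by
      rw [← smul_smul, ← smul_smul, zero_add]
      refine (X_pow_tmul_eq_iff (F := F) (i := 1)).1 ?_
      rw [TensorProduct.tmul_add, TensorProduct.tmul_smul, TensorProduct.tmul_smul β, ← hX,
        ← hY, TensorProduct.tmul_zero]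
      exact congrArg Subtype.val h
    have := hli _ _ h0
    exact ⟨(mul_eq_zero.1 this.1).resolve_right ha, (mul_eq_zero.1 this.2).resolve_right hb⟩
  · intro h3 V hV
    obtain ⟨u, hu, hVu⟩ := (mem_loopComponent 𝒮).1 hV
    -- Degree two is `(q-1) + 1 - (q-2)`. For `q > 3` the index `q - 2` is at least `2`, in the
    -- range killed by `Y`.
    rw [← tableDeg_eq_natCast (q := q) (t := 1) (m := q - 2) (by omega),
      H.component _ _ (by omega) (by omega), Submodule.mem_span_singleton] at hu
    obtain ⟨γ, rfl⟩ := hu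
    rw [eq_zero_iff_of_coe_eq (coe_lie_of_coe_eq hVu hY), smul_lie, lie_smul,
      H.lie_Y _ _ (by omega) (by omega), smul_zero, smul_zero]
  · intro V hV
    exact (H.lie_lie_of_mem hX hY (hmem V hV)).1
  · intro V hV
    exact (H.lie_lie_of_mem hX hY (hmem V hV)).2.1
  · intro V hV
    have h2 := (H.lie_lie_of_mem hX hY (hmem V hV)).2.2
    have hc : c 1 ≠ 0 := H.c_ne 1
    rw [Nat.cast_one, h1] at h2
    have h3 := congrArg ((c 1)⁻¹ • ·) h2
    simp only [smul_smul] at h3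
    rw [inv_mul_cancel₀ hc, one_smul] at h3
    rw [← h3]
    congr 1
    field_simp

-- Since `q > 3`, the element `v (q-2) 1` of degree two is killed by `v (q-1) 1` but not by `v 0 0`;
-- this forces `Y` to be a multiple of `v (q-1) 1`. For `X = a v 0 0 + b v (q-1) 1`, the relation
-- `[V,X,X] = 0` before the second diamond reads `a b (c 1 + d 1) = 0`, and `a = 0` would make `X`
-- and `Y` proportional.
omit ha hb hX hY in
theorem exists_of_isNottinghamPair (h3 : 3 < q) (hcd : c 1 + d 1 ≠ 0)
    {X Y : cyclicLoopAlgebra 𝒮}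
    (h : IsNottinghamPair (loopComponent 𝒮) q X Y) :
    ∃ a b : F, a ≠ 0 ∧ b ≠ 0 ∧
      (X : F[X] ⊗[F] S) = (Polynomial.X ^ 1 : F[X]) ⊗ₜ[F] (a • v 0 0) ∧
      (Y : F[X] ⊗[F] S) = (Polynomial.X ^ 1 : F[X]) ⊗ₜ[F] (b • v (q - 1) 1) := by
  obtain ⟨x, hx, hX⟩ := (mem_loopComponent 𝒮).1 h.mem_X
  obtain ⟨y, hy, hY⟩ := (mem_loopComponent 𝒮).1 h.mem_Y
  rw [Nat.cast_one] at hx hy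
  obtain ⟨a, b, rfl⟩ := H.mem_degree_one hx
  obtain ⟨a', b', rfl⟩ := H.mem_degree_one hy
  have hXne : X ≠ 0 := h.linearIndependent.ne_zero 0
  have hYne : Y ≠ 0 := h.linearIndependent.ne_zero 1
  have hd2 : tableDeg N q 1 (q - 2) = ((2 : ℕ) : ZMod N) :=
    tableDeg_eq_natCast (t := 1) (by omega)
  have hv2 : v (q - 2) 1 ∈ 𝒮 ((2 : ℕ) : ZMod N) := by
    rw [← hd2, H.component _ _ (by omega) (by omega)]
    exact Submodule.mem_span_singleton_self _
  have ha' : a' = 0 := by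
    have h1 := h.centralizes h3 ⟨_, H.isCyclicallyCovered.tmul_mem_cyclicLoopAlgebra
      (by omega) hv2⟩ ((mem_loopComponent 𝒮).2 ⟨_, hv2, rfl⟩)
    have h2 := H.lie_X 1 (q - 3) (by omega)
    rw [show q - 3 + 1 = q - 2 by omega] at h2
    rw [eq_zero_iff_of_coe_eq (coe_lie_of_coe_eq rfl hY), lie_add, lie_smul, lie_smul, h2,
      H.lie_Y _ _ (by omega) (by omega), smul_zero, add_zero] at h1
    exact (smul_eq_zero.1 h1).resolve_right (H.ne_zero _ _ (by omega) (by omega))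
  subst ha'
  rw [zero_smul, zero_add] at hY
  have hb' : b' ≠ 0 := by
    rintro rfl
    exact hYne ((eq_zero_iff_of_coe_eq hY).2 (zero_smul _ _))
  have hab : a * b = 0 := by
    obtain ⟨V, hV, hVe⟩ := H.exists_mem_loopComponent_pred_diamond (t := 1) le_rfl
    have h1 := h.lie_X_X V (by simpa using hV)
    rw [eq_zero_iff_of_coe_eq (coe_lie_of_coe_eq (coe_lie_of_coe_eq hVe hX) hX), Nat.cast_one] at h1
    simp only [add_lie, lie_add, smul_lie, lie_smul, H.lie_XX_one, H.lie_XY_one, H.lie_YX_one,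
      H.lie_YY_one, smul_zero, add_zero, zero_add, smul_smul, ← add_smul] at h1
    have h2 := (smul_eq_zero.1 h1).resolve_right (H.v_ne_zero _)
    refine (mul_eq_zero.1 (?_ : a * b * (c 1 + d 1) = 0)).resolve_right hcd
    linear_combination h2
  have ha : a ≠ 0 := by
    rintro rfl
    rw [zero_smul, zero_add] at hX
    have hli := h.linearIndependent
    rw [LinearIndependent.pair_iff] at hli
    refine hb' (hli b' (-b) ?_).1
    rw [eq_zero_iff_of_coe_eq (i := 1) (v := b' • b • v (q - 1) 1 + (-b) • b' • v (q - 1) 1)]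
    · module
    · rw [TensorProduct.tmul_add, ← coe_smul_of_coe_eq _ hX, ← coe_smul_of_coe_eq _ hY]
      rfl
  obtain rfl : b = 0 := (mul_eq_zero.1 hab).resolve_left ha
  rw [zero_smul, add_zero] at hX
  exact ⟨a, b', ha, hb', hX, hY⟩

end IsDiamondTable

/-! ### Binomial coefficients and falling factorials in characteristic `p`. -/

section Binomials

variable {F : Type*} [Field F] {p : ℕ} [Fact p.Prime] [CharP F p]

-- Lucas's theorem cut after the `s` lowest base-`p` digits: the product over those digits is again
-- the one computing `binom(b, d)`.
variable (F) in
theorem cast_choose_mul_pow_add (s a c : ℕ) {b d : ℕ} (hb : b < p ^ s) (hd : d < p ^ s) :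
    ((a * p ^ s + b).choose (c * p ^ s + d) : F) = (a.choose c : F) * (b.choose d : F) := by
  have hpos : 0 < p ^ s := Nat.pow_pos (Fact.out : p.Prime).pos
  have h1 := Choose.choose_modEq_choose_mul_prod_range_choose (p := p)
    (n := a * p ^ s + b) (k := c * p ^ s + d) s
  have h2 := Choose.choose_modEq_choose_mul_prod_range_choose (p := p) (n := b) (k := d) s
  have hdiv : ∀ (e x : ℕ), x < p ^ s → (e * p ^ s + x) / p ^ s = e := by
    intro e x hx
    rw [mul_comm, Nat.mul_add_div hpos, Nat.div_eq_of_lt hx, add_zero]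
  have hmod : ∀ (e x i : ℕ), i < s → (e * p ^ s + x) / p ^ i % p = x / p ^ i % p := by
    intro e x i hi
    obtain ⟨k, rfl⟩ : ∃ k, s = i + (k + 1) := ⟨s - i - 1, by omega⟩
    rw [show e * p ^ (i + (k + 1)) + x = p ^ i * (p * (e * p ^ k)) + x by ring,
      Nat.mul_add_div (Nat.pow_pos (Fact.out : p.Prime).pos), Nat.mul_add_mod]
  rw [hdiv _ _ hb, hdiv _ _ hd, Finset.prod_congr rfl fun i hi => by
    rw [hmod _ _ _ (Finset.mem_range.1 hi), hmod _ _ _ (Finset.mem_range.1 hi)]] at h1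
  rw [Nat.div_eq_of_lt hb, Nat.div_eq_of_lt hd, Nat.choose_self, Nat.cast_one, one_mul] at h2
  have h3 := h1.trans ((h2.symm).mul_left _)
  have h4 := (CharP.intCast_eq_intCast F p).2 h3
  exact_mod_cast h4

theorem factorial_cast_ne_zero {i : ℕ} (hi : i < p) : (i.factorial : F) ≠ 0 := by
  rw [Ne, CharP.cast_eq_zero_iff F p, (Fact.out : p.Prime).dvd_factorial]
  omega

theorem cast_factorial_pred : ((p - 1).factorial : F) = -1 := by
  have h := congrArg (ZMod.castHom dvd_rfl F) (ZMod.wilsons_lemma p)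
  rwa [map_natCast, map_neg, map_one] at h

/-- The factors `α - j` run over the roots `j ∈ 𝔽_p` of `X^p - X`. -/
theorem descPochhammer_eval_prime (α : F) : (descPochhammer F p).eval α = α ^ p - α := by
  have hp := (Fact.out : p.Prime)
  have h1 : (Polynomial.X ^ p - Polynomial.X : (ZMod p)[X]) =
      ∏ a : ZMod p, (Polynomial.X - Polynomial.C a) := by
    have hr : (Polynomial.X ^ p - Polynomial.X : (ZMod p)[X]).roots = Finset.univ.val := by
      have := FiniteField.roots_X_pow_card_sub_X (ZMod p)
      rwa [ZMod.card] at this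
    have hdeg := FiniteField.X_pow_card_sub_X_natDegree_eq (ZMod p) hp.one_lt
    have hm : (Polynomial.X ^ p - Polynomial.X : (ZMod p)[X]).Monic := by
      apply Polynomial.monic_X_pow_sub
      rw [Polynomial.degree_X]
      exact_mod_cast hp.one_lt
    have := Polynomial.prod_multiset_X_sub_C_of_monic_of_roots_card_eq hm
      (by rw [hr, hdeg]; simp [ZMod.card])
    rw [hr] at this
    exact this.symm
  have h2 := congrArg (Polynomial.eval₂ (ZMod.castHom dvd_rfl F) α) h1
  rw [Polynomial.eval₂_finsetProd] at h2
  simp only [Polynomial.eval₂_sub, Polynomial.eval₂_pow, Polynomial.eval₂_X,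
    Polynomial.eval₂_C] at h2
  rw [h2, descPochhammer_eval_eq_prod_range]
  refine Finset.prod_nbij' (fun j => (j : ZMod p)) ZMod.val (by simp)
    (fun a _ => Finset.mem_range.2 (ZMod.val_lt a)) ?_ (by simp) (by simp)
  intro j hj
  exact ZMod.val_natCast_of_lt (Finset.mem_range.1 hj)

end Binomials

/-! ### Truncated powers `(1 + u)^α`. -/

section OnePlusPow

variable {F A : Type*} [Field F] [CommRing A] [Algebra F A] {p : ℕ}

/-- The binomial coefficient `binom(α, i)` with an upper entry in a field. -/
def fieldChoose {F : Type*} [Field F] (α : F) (i : ℕ) : F :=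
  (descPochhammer F i).eval α / (i.factorial : F)

theorem onePlusPow_def (u : A) (α : F) :
    onePlusPow p u α = ∑ i ∈ Finset.range p, fieldChoose α i • u ^ i := rfl

theorem map_onePlusPow {B : Type*} [CommRing B] [Algebra F B] (f : A →ₐ[F] B) (u : A) (α : F) :
    f (onePlusPow p u α) = onePlusPow p (f u) α := by
  simp [onePlusPow, map_sum]

theorem descPochhammer_eval_add (α β : F) (k : ℕ) :
    (descPochhammer F k).eval (α + β) = ∑ ij ∈ Finset.HasAntidiagonal.antidiagonal k,
      (k.choose ij.1 : F) * ((descPochhammer F ij.1).eval α * (descPochhammer F ij.2).eval β) := by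
  have key : ∀ (n : ℕ) (x : F), (descPochhammer ℤ n).smeval x = (descPochhammer F n).eval x := by
    intro n x
    rw [← Polynomial.aeval_eq_smeval, ← descPochhammer_map (Int.castRingHom F),
      Polynomial.eval_map, Polynomial.aeval_def]
    rfl
  have := Ring.descPochhammer_smeval_add k (Commute.all α β)
  simpa only [key] using this

variable [Fact p.Prime] [CharP F p]

/-- Chu–Vandermonde for falling factorials, divided by `k!`, which is invertible because `k < p`. -/
theorem fieldChoose_add (α β : F) {k : ℕ} (hk : k < p) :
    fieldChoose (α + β) k =
      ∑ i ∈ Finset.range (k + 1), fieldChoose α i * fieldChoose β (k - i) := by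
  rw [fieldChoose, descPochhammer_eval_add, Finset.sum_div,
    Finset.Nat.sum_antidiagonal_eq_sum_range_succ_mk]
  refine Finset.sum_congr rfl fun i hi => ?_
  have hi' : i ≤ k := by
    have := Finset.mem_range.1 hi
    omega
  have h1 : (k.factorial : F) ≠ 0 := factorial_cast_ne_zero (p := p) hk
  have h2 : (i.factorial : F) ≠ 0 := factorial_cast_ne_zero (p := p) (by omega)
  have h3 : ((k - i).factorial : F) ≠ 0 := factorial_cast_ne_zero (p := p) (by omega)
  have h4 : (k.choose i : F) * i.factorial * (k - i).factorial = k.factorial := by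
    rw [← Nat.cast_mul, ← Nat.cast_mul, Nat.choose_mul_factorial_mul_factorial hi']
  rw [fieldChoose, fieldChoose, ← h4]
  rw [← h4] at h1
  have h5 : (k.choose i : F) ≠ 0 := fun h => h1 (by rw [h]; ring)
  field_simp

/-- The condition `u^p = 0` removes exactly the degrees `≥ p` in which Chu–Vandermonde is not
available. -/
theorem onePlusPow_mul {u : A} (hu : u ^ p = 0) (α β : F) :
    onePlusPow p u α * onePlusPow p u β = onePlusPow p u (α + β) := by
  rw [onePlusPow_def, onePlusPow_def, onePlusPow_def, Finset.sum_mul_sum]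
  have h1 : ∀ i ∈ Finset.range p, ∑ j ∈ Finset.range p,
      fieldChoose α i • u ^ i * fieldChoose β j • u ^ j =
      ∑ j ∈ Finset.range (p - i), (fieldChoose α i * fieldChoose β j) • u ^ (i + j) := by
    intro i hi
    have hi' := Finset.mem_range.1 hi
    rw [← Finset.sum_subset (Finset.range_mono (Nat.sub_le p i))]
    · refine Finset.sum_congr rfl fun j _ => ?_
      rw [smul_mul_smul_comm, pow_add]
    · intro j _ hj
      have : p ≤ i + j := by
        rw [Finset.mem_range] at hj
        omega
      rw [smul_mul_smul_comm, ← pow_add, ← Nat.sub_add_cancel this, pow_add, hu, mul_zero,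
        smul_zero]
  rw [Finset.sum_congr rfl h1, ← Finset.sum_range_diag_flip]
  refine Finset.sum_congr rfl fun k hk => ?_
  rw [fieldChoose_add (p := p) _ _ (Finset.mem_range.1 hk), Finset.sum_smul]
  refine Finset.sum_congr rfl fun i hi => ?_
  rw [Nat.add_sub_cancel' (Nat.lt_succ_iff.1 (Finset.mem_range.1 hi))]

omit [CharP F p] in
theorem onePlusPow_zero (u : A) : onePlusPow p u (0 : F) = 1 := by
  rw [onePlusPow_def, Finset.sum_eq_single 0]
  · simp [fieldChoose]
  · intro i _ hi
    simp [fieldChoose, descPochhammer_ne_zero_eval_zero F hi]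
  · intro h
    exact absurd (Finset.mem_range.2 (Fact.out : p.Prime).pos) h

omit [CharP F p] in
theorem onePlusPow_one (u : A) : onePlusPow p u (1 : F) = 1 + u := by
  have hp := (Fact.out : p.Prime).two_le
  rw [onePlusPow_def, ← Finset.sum_subset (Finset.range_mono hp)]
  · simp [Finset.sum_range_succ, fieldChoose]
  · intro i _ hi
    have : 1 < i := by
      rw [Finset.mem_range] at hi
      omega
    have h0 := descPochhammer_eval_coe_nat_of_lt (R := F) this
    rw [Nat.cast_one] at h0
    simp [fieldChoose, h0]

theorem onePlusPow_natCast {u : A} (hu : u ^ p = 0) (m : ℕ) :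
    onePlusPow p u (m : F) = (1 + u) ^ m := by
  induction m with
  | zero => rw [Nat.cast_zero, onePlusPow_zero, pow_zero]
  | succ m ih => rw [Nat.cast_succ, ← onePlusPow_mul hu, ih, onePlusPow_one, pow_succ]

omit [Fact p.Prime] [CharP F p] in
theorem mul_onePlusPow_of_mul_eq_zero (hp : 0 < p) {u z : A} (h : z * u = 0) (α : F) :
    z * onePlusPow p u α = z := by
  rw [onePlusPow_def, Finset.mul_sum, Finset.sum_eq_single 0]
  · simp [fieldChoose]
  · intro i _ hi
    obtain ⟨k, rfl⟩ := Nat.exists_eq_succ_of_ne_zero hi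
    rw [pow_succ', mul_smul_comm, ← mul_assoc, h, zero_mul, smul_zero]
  · intro h
    exact absurd (Finset.mem_range.2 hp) h

omit [CharP F p] [Fact p.Prime] in
theorem fieldChoose_succ_mul (α : F) {i : ℕ} (hi : ((i + 1).factorial : F) ≠ 0) :
    fieldChoose α (i + 1) * (i + 1 : ℕ) = α * fieldChoose (α - 1) i := by
  have h1 : ((i + 1 : ℕ) : F) * (i.factorial : F) = ((i + 1).factorial : F) := by
    rw [← Nat.cast_mul, ← Nat.factorial_succ]
  rw [← h1] at hi
  have h2 := left_ne_zero_of_mul hi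
  have h3 := right_ne_zero_of_mul hi
  rw [fieldChoose, fieldChoose, ← h1, descPochhammer_succ_left, Polynomial.eval_mul,
    Polynomial.eval_comp, Polynomial.eval_X, Polynomial.eval_sub, Polynomial.eval_X,
    Polynomial.eval_one]
  field_simp

/-- The left side is `α(α-1)⋯(α-p+1) / (p-1)!`, and `(p-1)! = -1` by Wilson. This is the defect in
the chain rule for truncated powers. -/
theorem mul_fieldChoose_pred (α : F) :
    α * fieldChoose (α - 1) (p - 1) = -(α ^ p - α) := by
  have h := descPochhammer_eval_prime (p := p) α
  obtain ⟨k, hk⟩ : ∃ k, p = k + 1 := ⟨p - 1, (Nat.sub_add_cancel (Fact.out : p.Prime).pos).symm⟩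
  have h2 : (descPochhammer F (k + 1)).eval α = α ^ p - α := by rw [← hk, h]
  rw [descPochhammer_succ_left, Polynomial.eval_mul, Polynomial.eval_comp, Polynomial.eval_X,
    Polynomial.eval_sub, Polynomial.eval_X, Polynomial.eval_one] at h2
  rw [fieldChoose, cast_factorial_pred, show p - 1 = k by omega, ← h2, div_neg, div_one]
  ring

/-- The chain rule for truncated powers, with its correction in the top power of `u`. -/
theorem derivation_onePlusPow (D : A →ₗ[F] A) (hD : ∀ a b, D (a * b) = D a * b + a * D b)
    (u : A) (α : F) : D (onePlusPow p u α) =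
      α • (onePlusPow p u (α - 1) * D u) + (α ^ p - α) • (u ^ (p - 1) * D u) := by
  have hD1 : D 1 = 0 := by
    have := hD 1 1
    simpa using this
  have hpow : ∀ i : ℕ, D (u ^ (i + 1)) = ((i + 1 : ℕ) : F) • (u ^ i * D u) := by
    intro i
    induction i with
    | zero => simp
    | succ i ih =>
      rw [pow_succ, hD, ih, Nat.cast_succ (i + 1), add_smul, one_smul, smul_mul_assoc]
      congr 2
      ring
  obtain ⟨k, hk⟩ : ∃ k, p = k + 1 := ⟨p - 1, (Nat.sub_add_cancel (Fact.out : p.Prime).pos).symm⟩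
  have h1 : D (onePlusPow p u α) =
      ∑ i ∈ Finset.range k, (α * fieldChoose (α - 1) i) • (u ^ i * D u) := by
    rw [onePlusPow_def, hk, Finset.sum_range_succ', map_add, map_sum]
    simp only [pow_zero, map_smul, hD1, smul_zero, add_zero]
    refine Finset.sum_congr rfl fun i hi => ?_
    rw [hpow, smul_smul, fieldChoose_succ_mul]
    apply factorial_cast_ne_zero (p := p)
    have := Finset.mem_range.1 hi
    omega
  -- The truncation of `(1+u)^(α-1)` reaches `u^(p-1)`, while differentiating the truncation of
  -- `(1+u)^α` stops at `u^(p-2)`; the surplus top term is the correction.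
  have h2 : α • (onePlusPow p u (α - 1) * D u) =
      ∑ i ∈ Finset.range k, (α * fieldChoose (α - 1) i) • (u ^ i * D u)
        - (α ^ p - α) • (u ^ (p - 1) * D u) := by
    have h3 := mul_fieldChoose_pred (p := p) α
    have hk' : p - 1 = k := by omega
    rw [hk'] at h3 ⊢
    rw [onePlusPow_def, hk, Finset.sum_range_succ, add_mul, Finset.sum_mul, smul_add,
      Finset.smul_sum]
    simp only [smul_mul_assoc, smul_smul]
    rw [h3, neg_smul, ← hk, ← sub_eq_add_neg]
  rw [h1, h2, sub_add_cancel]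

end OnePlusPow

/-! ### The twisted derivative on the elements `(1 + σ x^(p^s))^α x^(k)`. -/

namespace DivPow

variable {F : Type*} [Field F] {p m : ℕ} [Fact p.Prime] [CharP F p]

instance : Module.Finite F (DivPow F p m) := inferInstanceAs (Module.Finite F (Fin (p ^ m) → F))

theorem finrank_eq : Module.finrank F (DivPow F p m) = p ^ m := by
  have : Module.finrank F (Fin (p ^ m) → F) = p ^ m := by simp
  exact this

theorem deriv_dp_mul_dp {i j : ℕ} (hi : i < p ^ m) (hij : 0 < i + j) :
    deriv F p m (dp F p m i) * dp F p m j
      = ((i + j - 1).choose j : F) • dp F p m (i + j - 1) := by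
  rcases i with _ | i
  · rw [deriv_dp_zero, zero_mul, Nat.choose_eq_zero_of_lt (by omega), Nat.cast_zero, zero_smul]
  · rw [deriv_dp_succ hi, dp_mul_dp, show i + 1 + j - 1 = i + j by omega, Nat.choose_symm_add]

theorem dp_mul_deriv_dp {i j : ℕ} (hj : j < p ^ m) (hij : 0 < i + j) :
    dp F p m i * deriv F p m (dp F p m j)
      = ((i + j - 1).choose i : F) • dp F p m (i + j - 1) := by
  rw [mul_comm, deriv_dp_mul_dp hj (by omega), add_comm]

/-- The operator `∂ + x̄`, which sends `x^(0)` to `x̄`. -/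
def twistedDeriv (f : DivPow F p m) : DivPow F p m :=
  deriv F p m f + dp F p m (p ^ m - 1) * f

variable {s : ℕ}

theorem dp_pow (i : ℕ) :
    dp F p (s + 1) (p ^ s) ^ i = (i.factorial : F) • dp F p (s + 1) (i * p ^ s) := by
  have hpos : 0 < p ^ s := Nat.pow_pos (Fact.out : p.Prime).pos
  induction i with
  | zero => simp [one_def]
  | succ i ih =>
    have h1 := cast_choose_mul_pow_add F (p := p) s (i + 1) i hpos hpos
    simp only [add_zero, Nat.choose_self, Nat.choose_succ_self_right, Nat.cast_one, mul_one] at h1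
    rw [pow_succ, ih, smul_mul_assoc, dp_mul_dp, show i * p ^ s + p ^ s = (i + 1) * p ^ s by ring,
      h1, smul_smul, Nat.factorial_succ]
    congr 1
    push_cast
    ring

theorem dp_mul_pow_mul_dp (i : ℕ) {k : ℕ} (hk : k < p ^ s) :
    dp F p (s + 1) (i * p ^ s) * dp F p (s + 1) k = dp F p (s + 1) (i * p ^ s + k) := by
  have hpos : 0 < p ^ s := Nat.pow_pos (Fact.out : p.Prime).pos
  have h1 := cast_choose_mul_pow_add F (p := p) s i i hk hpos
  simp only [add_zero, Nat.choose_self, Nat.choose_zero_right, Nat.cast_one, mul_one] at h1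
  rw [dp_mul_dp, h1, one_smul]

/-- Here `N = p^s + b` with `b < k`, so adding `k` and `N - k` carries out of the lowest `s` digits.
-/
theorem choose_cast_eq_zero_of_carry {k N : ℕ} (hk : k < p ^ s) (hN : p ^ s ≤ N)
    (hl : N < p ^ s + k) : (N.choose k : F) = 0 := by
  have hpos : 0 < p ^ s := Nat.pow_pos (Fact.out : p.Prime).pos
  have h1 := cast_choose_mul_pow_add F (p := p) s 1 0 (b := N - p ^ s) (d := k) (by omega) hk
  rw [one_mul, zero_mul, zero_add, Nat.add_sub_cancel' hN] at h1
  rw [h1, Nat.choose_eq_zero_of_lt (show N - p ^ s < k by omega), Nat.cast_zero, mul_zero]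

variable (p s) in
/-- The element `(1 + σ x^(p ^ s)) ^ α x^(k)` of `O(1; s + 1)`. -/
def twistedDp (σ α : F) (k : ℕ) : DivPow F p (s + 1) :=
  onePlusPow p (σ • dp F p (s + 1) (p ^ s)) α * dp F p (s + 1) k

variable (σ : F)

theorem smul_dp_pow_prime : (σ • dp F p (s + 1) (p ^ s)) ^ p = 0 := by
  rw [smul_pow, dp_pow, dp_of_le (by rw [pow_succ']), smul_zero, smul_zero]

theorem twistedDp_mul (α β : F) (k l : ℕ) :
    twistedDp p s σ α k * twistedDp p s σ β l
      = ((k + l).choose k : F) • twistedDp p s σ (α + β) (k + l) := by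
  rw [twistedDp, twistedDp, twistedDp, mul_mul_mul_comm, onePlusPow_mul (smul_dp_pow_prime σ),
    dp_mul_dp, mul_smul_comm]

theorem deriv_smul_dp : deriv F p (s + 1) (σ • dp F p (s + 1) (p ^ s))
    = σ • dp F p (s + 1) (p ^ s - 1) := by
  have hpos : 0 < p ^ s := Nat.pow_pos (Fact.out : p.Prime).pos
  have hlt : p ^ s < p ^ (s + 1) :=
    Nat.pow_lt_pow_right (Fact.out : p.Prime).one_lt (Nat.lt_succ_self s)
  have h := deriv_dp_succ (F := F) (p := p) (m := s + 1) (i := p ^ s - 1) (by omega)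
  rw [Nat.sub_add_cancel hpos] at h
  rw [map_smul, h]

/-- The correction of the chain rule lands in `x̄`: with `(p-1)! = -1` one finds `u^(p-1) ∂u = -σ^p
x̄`. -/
theorem deriv_onePlusPow (α : F) :
    deriv F p (s + 1) (onePlusPow p (σ • dp F p (s + 1) (p ^ s)) α) =
      (α * σ) • twistedDp p s σ (α - 1) (p ^ s - 1)
        - ((α ^ p - α) * σ ^ p) • dp F p (s + 1) (p ^ (s + 1) - 1) := by
  have hp := (Fact.out : p.Prime).pos
  have hpos : 0 < p ^ s := Nat.pow_pos hp
  have h1 : (p - 1) * p ^ s + (p ^ s - 1) = p ^ (s + 1) - 1 := by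
    obtain ⟨k, hk⟩ : ∃ k, p = k + 1 := ⟨p - 1, by omega⟩
    have : p ^ (s + 1) = (p - 1) * p ^ s + p ^ s := by
      rw [pow_succ', ← Nat.succ_mul, Nat.succ_eq_add_one, Nat.sub_add_cancel hp]
    omega
  have h2 : σ ^ (p - 1) * σ = σ ^ p := by rw [← pow_succ, Nat.sub_add_cancel hp]
  rw [derivation_onePlusPow _ (deriv_mul (F := F)), deriv_smul_dp, smul_pow, dp_pow,
    cast_factorial_pred, smul_smul, smul_mul_smul_comm, dp_mul_pow_mul_dp _ (by omega), h1,
    twistedDp, mul_smul_comm, smul_smul, smul_smul,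
    show (α ^ p - α) * (σ ^ (p - 1) * -1 * σ) = -((α ^ p - α) * σ ^ p) by
      linear_combination -(α ^ p - α) * h2, neg_smul, ← sub_eq_add_neg]

theorem top_mul_smul_dp : dp F p (s + 1) (p ^ (s + 1) - 1) * (σ • dp F p (s + 1) (p ^ s)) = 0 := by
  have hpos : 0 < p ^ s := Nat.pow_pos (Fact.out : p.Prime).pos
  rw [mul_smul_comm, dp_mul_dp, dp_of_le (by omega), smul_zero, smul_zero]

theorem top_mul_twistedDp_succ (α : F) (k : ℕ) :
    dp F p (s + 1) (p ^ (s + 1) - 1) * twistedDp p s σ α (k + 1) = 0 := by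
  rw [twistedDp, mul_left_comm, dp_mul_dp,
    dp_of_le (i := p ^ (s + 1) - 1 + (k + 1)) (by omega), smul_zero, mul_zero]

theorem top_mul_twistedDp_zero (α : F) :
    dp F p (s + 1) (p ^ (s + 1) - 1) * twistedDp p s σ α 0
      = dp F p (s + 1) (p ^ (s + 1) - 1) := by
  rw [twistedDp, ← one_def, mul_one,
    mul_onePlusPow_of_mul_eq_zero (Fact.out : p.Prime).pos (top_mul_smul_dp σ)]

theorem twistedDp_pred_mul_dp_succ (α : F) {k : ℕ} (hk : k + 1 < p ^ s) :
    twistedDp p s σ α (p ^ s - 1) * dp F p (s + 1) (k + 1) = 0 := by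
  rw [twistedDp, mul_assoc, dp_mul_dp, Nat.choose_symm_add,
    choose_cast_eq_zero_of_carry (s := s) hk (by omega) (by omega), zero_smul, mul_zero]

/-- The factor `x^(k+1)` annihilates both terms of `∂(1+u)^α`, one by a carry and one by exceeding
the range, as well as `x̄`. Hence the power of `1 + u` behaves like a constant. -/
theorem twistedDeriv_twistedDp_succ (α : F) {k : ℕ} (hk : k + 1 < p ^ s) :
    twistedDeriv (twistedDp p s σ α (k + 1)) = twistedDp p s σ α k := by
  have hlt : p ^ s < p ^ (s + 1) :=
    Nat.pow_lt_pow_right (Fact.out : p.Prime).one_lt (Nat.lt_succ_self s)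
  rw [twistedDeriv, top_mul_twistedDp_succ, add_zero, twistedDp, deriv_mul, deriv_onePlusPow,
    deriv_dp_succ (by omega), sub_mul, smul_mul_assoc, smul_mul_assoc,
    twistedDp_pred_mul_dp_succ σ _ hk, dp_mul_dp, dp_of_le (by omega)]
  simp [twistedDp]

theorem twistedDeriv_twistedDp_zero (α : F) :
    twistedDeriv (twistedDp p s σ α 0) = (α * σ) • twistedDp p s σ (α - 1) (p ^ s - 1)
      + (1 - (α ^ p - α) * σ ^ p) • dp F p (s + 1) (p ^ (s + 1) - 1) := by
  rw [twistedDeriv, top_mul_twistedDp_zero, twistedDp, ← one_def, mul_one, deriv_onePlusPow,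
    sub_smul, one_smul]
  abel

theorem twistedDp_mul_twistedDeriv (α β : F) (k : ℕ) {l : ℕ} (hk : k < p ^ s) (hl : l < p ^ s)
    (hkl : 0 < k + l) :
    twistedDp p s σ α k * twistedDeriv (twistedDp p s σ β l)
      = ((k + l - 1).choose k : F) • twistedDp p s σ (α + β) (k + l - 1) := by
  rcases l with _ | l
  · obtain ⟨k, rfl⟩ : ∃ k', k = k' + 1 := ⟨k - 1, by omega⟩
    rw [twistedDeriv_twistedDp_zero, Nat.choose_eq_zero_of_lt (by omega), Nat.cast_zero, zero_smul,
      mul_add, mul_smul_comm, mul_smul_comm, mul_comm _ (dp F p (s + 1) _),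
      top_mul_twistedDp_succ, twistedDp.eq_1 p s σ α, mul_right_comm, mul_assoc,
      twistedDp_pred_mul_dp_succ σ _ hk]
    simp
  · rw [twistedDeriv_twistedDp_succ σ β hl, twistedDp_mul]
    rfl

theorem twistedDp_zero_mul_twistedDeriv (α β : F) :
    twistedDp p s σ α 0 * twistedDeriv (twistedDp p s σ β 0)
      = (β * σ) • twistedDp p s σ (α + β - 1) (p ^ s - 1)
      + (1 - (β ^ p - β) * σ ^ p) • dp F p (s + 1) (p ^ (s + 1) - 1) := by
  rw [twistedDeriv_twistedDp_zero, mul_add, mul_smul_comm, mul_smul_comm, twistedDp_mul,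
    mul_comm _ (dp F p (s + 1) _), top_mul_twistedDp_zero]
  simp [add_sub_assoc]

/-- Each `x^(i)` is a nonzero multiple of a power of `u` times some `x^(k)`, `k < p^s`; expanding `u
= (1+u) - 1` gives the exponents `0, …, p-1`. Multiplication by the invertible `(1+u)^α` shifts
them. -/
theorem mem_span_twistedDp (hσ : σ ≠ 0) (α : F) (f : DivPow F p (s + 1)) :
    f ∈ Submodule.span F {z | ∃ a < p, ∃ k < p ^ s, z = twistedDp p s σ (α + (a : ℕ)) k} := by
  set u := σ • dp F p (s + 1) (p ^ s) with hu
  have hup : u ^ p = 0 := smul_dp_pow_prime σ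
  have hpos : 0 < p ^ s := Nat.pow_pos (Fact.out : p.Prime).pos
  have h0 : ∀ g : DivPow F p (s + 1),
      g ∈ Submodule.span F {z | ∃ a < p, ∃ k < p ^ s, z = twistedDp p s σ ((a : ℕ) : F) k} := by
    intro g
    induction g using induction with
    | h0 => exact zero_mem _
    | hadd f g hf hg => exact add_mem hf hg
    | hsmul c f hf => exact Submodule.smul_mem _ _ hf
    | hdp i hi =>
      have hip : i / p ^ s < p := by
        rw [Nat.div_lt_iff_lt_mul hpos, ← pow_succ']
        exact hi
      have hk := Nat.mod_lt i hpos
      have hne : σ ^ (i / p ^ s) * ((i / p ^ s).factorial : F) ≠ 0 :=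
        mul_ne_zero (pow_ne_zero _ hσ) (factorial_cast_ne_zero hip)
      have h1 : u ^ (i / p ^ s) * dp F p (s + 1) (i % p ^ s)
          = (σ ^ (i / p ^ s) * ((i / p ^ s).factorial : F)) • dp F p (s + 1) i := by
        rw [hu, smul_pow, dp_pow, smul_smul, smul_mul_assoc, dp_mul_pow_mul_dp _ hk,
          Nat.div_add_mod']
      have h2 : u ^ (i / p ^ s) * dp F p (s + 1) (i % p ^ s) ∈
          Submodule.span F {z | ∃ a < p, ∃ k < p ^ s, z = twistedDp p s σ ((a : ℕ) : F) k} := by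
        have h3 : u ^ (i / p ^ s) = ((1 + u) + (-1)) ^ (i / p ^ s) := by ring
        rw [h3, add_pow, Finset.sum_mul]
        refine Submodule.sum_mem _ fun c hc => ?_
        have hc' := Finset.mem_range.1 hc
        have h4 : (1 + u) ^ c * (-1) ^ (i / p ^ s - c) * ((i / p ^ s).choose c : DivPow F p (s + 1))
            * dp F p (s + 1) (i % p ^ s)
            = ((-1 : F) ^ (i / p ^ s - c) * ((i / p ^ s).choose c : F)) •
              twistedDp p s σ (c : F) (i % p ^ s) := by
          rw [twistedDp, onePlusPow_natCast hup, Algebra.smul_def, map_mul, map_pow, map_neg,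
            map_one, map_natCast]
          ring
        rw [h4]
        exact Submodule.smul_mem _ _ (Submodule.subset_span ⟨c, by omega, _, hk, rfl⟩)
      rw [h1] at h2
      exact (Submodule.smul_mem_iff _ hne).1 h2
  have h1 : f = onePlusPow p u α * (onePlusPow p u (-α) * f) := by
    rw [← mul_assoc, onePlusPow_mul hup, add_neg_cancel, onePlusPow_zero, one_mul]
  rw [h1]
  refine Submodule.span_induction (p := fun g _ => onePlusPow p u α * g ∈ _) ?_ ?_ ?_ ?_
    (h0 (onePlusPow p u (-α) * f))
  · rintro _ ⟨a, ha, k, hk, rfl⟩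
    refine Submodule.subset_span ⟨a, ha, k, hk, ?_⟩
    rw [twistedDp, twistedDp, ← mul_assoc, onePlusPow_mul hup]
  · rw [mul_zero]
    exact zero_mem _
  · intro a b _ _ ha hb
    rw [mul_add]
    exact add_mem ha hb
  · intro c a _ ha
    rw [mul_smul_comm]
    exact Submodule.smul_mem _ _ ha

end DivPow

/-! ### Brackets of table elements. -/

namespace AlbertZassenhaus

variable {F : Type*} [Field F] {p n s : ℕ} [Fact p.Prime] [CharP F p]

theorem lie_of_tmul (a b : DivPow F p s) (f g : DivPow F p n) :
    (⁅of (a ⊗ₜ[F] f), of (b ⊗ₜ[F] g)⁆ : AlbertZassenhaus F p s n) =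
      of ((a * DivPow.twistedDeriv b) ⊗ₜ[F] (DivPow.deriv F p n f * g)
        - (DivPow.twistedDeriv a * b) ⊗ₜ[F] (f * DivPow.deriv F p n g)) := by
  rw [lie_of]
  congr 1
  have h : ∀ (b : DivPow F p s) (g : DivPow F p n), DivPow₂.dx F p s n (b ⊗ₜ[F] g)
      + DivPow₂.xbar F p s n * b ⊗ₜ[F] g = (DivPow.twistedDeriv b) ⊗ₜ[F] g := by
    intro b g
    rw [DivPow₂.dx, TensorProduct.map_tmul, LinearMap.id_apply, DivPow₂.xbar, DivPow₂.mono,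
      Algebra.TensorProduct.tmul_mul_tmul, ← DivPow.one_def, one_mul, ← TensorProduct.add_tmul,
      DivPow.twistedDeriv]
  rw [poisson, h, h, DivPow₂.dy, TensorProduct.map_tmul, TensorProduct.map_tmul,
    LinearMap.id_apply, LinearMap.id_apply, Algebra.TensorProduct.tmul_mul_tmul,
    Algebra.TensorProduct.tmul_mul_tmul]

variable (p n s) in
/-- The element `(1 + σ x^(p ^ s)) ^ (a - (m - 1) π) x^(k) y^(m)` with `a p ^ s + k = 1 - t`,
`0 ≤ k < p ^ s`. -/
def tableElt (σ π : F) (m : ℕ) (t : ℤ) : AlbertZassenhaus F p (s + 1) n :=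
  of (DivPow.twistedDp p s σ (-((m : F) - 1) * π + (((1 - t) / (p : ℤ) ^ s : ℤ) : F))
    ((1 - t) % (p : ℤ) ^ s).toNat ⊗ₜ[F] DivPow.dp F p n m)

theorem tableElt_of_eq (σ π : F) (m : ℕ) {t a : ℤ} {k : ℕ} (hk : k < p ^ s)
    (h : 1 - t = a * (p : ℤ) ^ s + k) : tableElt p n s σ π m t =
      of (DivPow.twistedDp p s σ (-((m : F) - 1) * π + (a : F)) k ⊗ₜ[F] DivPow.dp F p n m) := by
  have hk' : (k : ℤ) < (p : ℤ) ^ s := by exact_mod_cast hk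
  have hdiv : (1 - t) / (p : ℤ) ^ s = a := by
    rw [h, add_comm, Int.add_mul_ediv_right _ _ (by omega), Int.ediv_eq_zero_of_lt (by omega) hk',
      zero_add]
  have hmod : (1 - t) % (p : ℤ) ^ s = k := by
    rw [h, add_comm, Int.add_mul_emod_self_right, Int.emod_eq_of_lt (by omega) hk']
  rw [tableElt, hdiv, hmod, Int.toNat_natCast]

variable (p s) in
theorem exists_table_coords (t : ℤ) :
    ∃ (a : ℤ) (k : ℕ), k < p ^ s ∧ 1 - t = a * (p : ℤ) ^ s + k := by
  have hpos : 0 < (p : ℤ) ^ s := by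
    have : 0 < p ^ s := Nat.pow_pos (Fact.out : p.Prime).pos
    exact_mod_cast this
  have h1 := Int.emod_nonneg (1 - t) hpos.ne'
  have h2 := Int.emod_lt_of_pos (1 - t) hpos
  refine ⟨(1 - t) / (p : ℤ) ^ s, ((1 - t) % (p : ℤ) ^ s).toNat, ?_, ?_⟩
  · zify
    omega
  · rw [Int.toNat_of_nonneg h1, mul_comm, Int.mul_ediv_add_emod]

theorem tableElt_of_le (σ π : F) {m : ℕ} (hm : p ^ n ≤ m) (t : ℤ) :
    tableElt p n s σ π m t = 0 := by
  rw [tableElt, DivPow.dp_of_le hm, TensorProduct.tmul_zero, map_zero]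

/-- A shift of `t` by a multiple of `p^(s+1)` keeps `k` and changes `a` by a multiple of `p`,
invisible in `F`. -/
theorem tableElt_periodic (σ π : F) (m : ℕ) {t t' : ℤ} (h : (p : ℤ) ^ (s + 1) ∣ t - t') :
    tableElt p n s σ π m t = tableElt p n s σ π m t' := by
  obtain ⟨a, k, hk, ha⟩ := exists_table_coords p s t
  obtain ⟨c, hc⟩ := h
  have ha' : 1 - t' = (a + p * c) * (p : ℤ) ^ s + k := by
    rw [pow_succ] at hc
    linear_combination ha + hc
  rw [tableElt_of_eq σ π m hk ha, tableElt_of_eq σ π m hk ha']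
  simp

theorem lie_tableElt_zero (σ π : F) (t t' : ℤ) :
    ⁅tableElt p n s σ π 0 t, tableElt p n s σ π 0 t'⁆ = 0 := by
  rw [tableElt, tableElt, lie_of_tmul, DivPow.deriv_dp_zero]
  simp

theorem lie_tableElt_of_pos (σ π : F) {m m' : ℕ} (hm : m < p ^ n) (hm' : m' < p ^ n)
    (hmm : 0 < m + m') {t t' a a' : ℤ} {k k' : ℕ} (hk : k < p ^ s) (hk' : k' < p ^ s)
    (ht : 1 - t = a * (p : ℤ) ^ s + k) (ht' : 1 - t' = a' * (p : ℤ) ^ s + k') (hkk : 0 < k + k') :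
    ⁅tableElt p n s σ π m t, tableElt p n s σ π m' t'⁆ =
      (((k + k' - 1).choose k : F) * ((m + m' - 1).choose m' : F)
        - ((k + k' - 1).choose k' : F) * ((m + m' - 1).choose m : F)) •
        tableElt p n s σ π (m + m' - 1) (t + t') := by
  rw [tableElt_of_eq σ π m hk ht, tableElt_of_eq σ π m' hk' ht', lie_of_tmul,
    DivPow.deriv_dp_mul_dp hm hmm, DivPow.dp_mul_deriv_dp hm' hmm,
    mul_comm (DivPow.twistedDeriv _),
    DivPow.twistedDp_mul_twistedDeriv σ _ _ _ hk hk' hkk,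
    DivPow.twistedDp_mul_twistedDeriv σ _ _ _ hk' hk (by omega), add_comm k' k]
  have hexp : -((m : F) - 1) * π + (a : F) + (-((m' : F) - 1) * π + (a' : F))
      = -(((m + m' - 1 : ℕ) : F) - 1) * π + ((a + a' : ℤ) : F) := by
    rw [Nat.cast_sub (by omega)]
    push_cast
    ring
  rw [add_comm (-((m' : F) - 1) * π + (a' : F)), hexp]
  rw [TensorProduct.smul_tmul_smul, TensorProduct.smul_tmul_smul, ← sub_smul, map_smul]
  -- If `k + k' - 1` overflows, the coordinates of `t + t'` are different ones, but both binomial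
  -- coefficients have a carry and vanish.
  rcases Nat.lt_or_ge (k + k' - 1) (p ^ s) with h | h
  · rw [tableElt_of_eq (t := t + t') σ π _ h (a := a + a')]
    rw [Nat.cast_sub (by omega)]
    push_cast
    linear_combination ht + ht'
  · rw [DivPow.choose_cast_eq_zero_of_carry hk h (by omega),
      DivPow.choose_cast_eq_zero_of_carry hk' h (by omega)]
    simp

/-- The relation between `σ` and `π`, together with the choice of the exponents, makes the stray
multiples of `x̄` have coefficients `m'` and `m` (`hfrob`); these cancel in the bracket (`hnum`),
leaving one table element. -/
theorem lie_tableElt_of_zero {σ π : F} (hσπ : (π ^ p - π) * σ ^ p = 1) {m m' : ℕ}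
    (hm : m < p ^ n) (hm' : m' < p ^ n)
    (hmm : 0 < m + m') {t t' a a' : ℤ} (ht : 1 - t = a * (p : ℤ) ^ s)
    (ht' : 1 - t' = a' * (p : ℤ) ^ s) :
    ⁅tableElt p n s σ π m t, tableElt p n s σ π m' t'⁆ =
      (σ * ((-((m' : F) - 1) * π + (a' : F)) * ((m + m' - 1).choose m' : F)
        - (-((m : F) - 1) * π + (a : F)) * ((m + m' - 1).choose m : F))) •
        tableElt p n s σ π (m + m' - 1) (t + t') := by
  have hpos : 0 < p ^ s := Nat.pow_pos (Fact.out : p.Prime).pos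
  have hfrob : ∀ (m : ℕ) (a : ℤ), 1 - ((-((m : F) - 1) * π + (a : F)) ^ p
      - (-((m : F) - 1) * π + (a : F))) * σ ^ p = m := by
    intro m a
    have h1 : (-((m : F) - 1) * π + (a : F)) ^ p = -((m : F) - 1) * π ^ p + (a : F) := by
      have h2 : (-((m : F) - 1)) = ((1 - m : ℤ) : F) := by
        push_cast
        ring
      have h3 : ∀ z : ℤ, (z : F) ^ p = z := by
        intro z
        have := congrArg (ZMod.castHom dvd_rfl F) (ZMod.pow_card (z : ZMod p))
        rwa [map_pow, map_intCast] at this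
      rw [h2, add_pow_char, mul_pow, h3, h3]
    rw [h1]
    linear_combination ((m : F) - 1) * hσπ
  have hnum : (m' : F) * ((m + m' - 1).choose m' : F) = m * ((m + m' - 1).choose m : F) := by
    rcases m with _ | m
    · rw [Nat.choose_eq_zero_of_lt (show 0 + m' - 1 < m' by omega)]
      simp
    rcases m' with _ | m'
    · simp
    have h1 : (m' + 1) * (m + 1 + m').choose (m' + 1) = (m + 1 + m').choose (m + 1) * (m + 1) := by
      rw [mul_comm, Nat.choose_succ_right_eq]
      have h2 := Nat.choose_succ_right_eq (m + 1 + m') m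
      have h3 : (m + 1 + m').choose m' = (m + 1 + m').choose (m + 1) := Nat.choose_symm_add.symm
      rw [h3, show m + 1 + m' - m' = m + 1 by omega]
    have h2 := congrArg (Nat.cast (R := F)) h1
    rw [show m + 1 + (m' + 1) - 1 = m + 1 + m' by omega]
    rw [Nat.cast_mul, Nat.cast_mul] at h2
    rw [h2, mul_comm]
  have hexp : -((m : F) - 1) * π + (a : F) + (-((m' : F) - 1) * π + (a' : F)) - 1
      = -(((m + m' - 1 : ℕ) : F) - 1) * π + ((a + a' - 1 : ℤ) : F) := by
    rw [Nat.cast_sub (by omega)]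
    push_cast
    ring
  -- Both `k` are zero, so the drop by one borrows from `a + a'`, matching the exponent `α - 1` and
  -- the factor `x^(p^s-1)` of the derivative.
  have hT : 1 - (t + t') = (a + a' - 1) * (p : ℤ) ^ s + (p ^ s - 1 : ℕ) := by
    rw [Nat.cast_sub (by omega)]
    push_cast
    linear_combination ht + ht'
  rw [tableElt_of_eq σ π m hpos (k := 0) (a := a) (by simpa using ht),
    tableElt_of_eq σ π m' hpos (k := 0) (a := a') (by simpa using ht'), lie_of_tmul,
    DivPow.deriv_dp_mul_dp hm hmm, DivPow.dp_mul_deriv_dp hm' hmm,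
    mul_comm (DivPow.twistedDeriv _), DivPow.twistedDp_zero_mul_twistedDeriv,
    DivPow.twistedDp_zero_mul_twistedDeriv, hfrob, hfrob,
    add_comm (-((m' : F) - 1) * π + (a' : F)), hexp,
    tableElt_of_eq σ π _ (by omega) hT, ← map_smul]
  congr 1
  simp only [TensorProduct.add_tmul, TensorProduct.tmul_smul, ← TensorProduct.smul_tmul',
    smul_smul, smul_add]
  rw [mul_comm _ (m' : F), mul_comm _ (m : F), hnum]
  module

end AlbertZassenhaus

/-! ### Passage between the indices `(j, k, a)` and `(m, t)`. -/

namespace AlbertZassenhaus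

variable {F : Type*} [Field F] {p n s : ℕ} [Fact p.Prime] [CharP F p]

theorem eElt_eq_of_tmul (σ π : F) (j k : ℤ) (a : ZMod p) :
    eElt p n s σ π j k a = of (DivPow.twistedDp p s σ
      (-(j : F) * π + ZMod.castHom dvd_rfl F a) (k + 1).toNat
        ⊗ₜ[F] DivPow.dp F p n (j + 1).toNat) := by
  have h : σ • DivPow₂.mono F p (s + 1) n (p ^ s) 0 =
      (Algebra.TensorProduct.includeLeft : DivPow F p (s + 1) →ₐ[F] DivPow₂ F p (s + 1) n)
        (σ • DivPow.dp F p (s + 1) (p ^ s)) := by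
    rw [map_smul]
    rfl
  rw [eElt, h, ← map_onePlusPow, Algebra.TensorProduct.includeLeft_apply, DivPow₂.mono,
    Algebra.TensorProduct.tmul_mul_tmul, one_mul]
  rfl

theorem eElt_eq_tableElt (σ π : F) (i : EIndex p n s) :
    eElt p n s σ π i.1 i.2.1 i.2.2 = tableElt p n s σ π ((i.1 : ℤ) + 1).toNat
      (-((i.2.2.val : ℤ) * (p : ℤ) ^ s + i.2.1)) := by
  obtain ⟨⟨j, hj1, hj2⟩, ⟨k, hk1, hk2⟩, a⟩ := i
  dsimp only
  have hk : (k + 1).toNat < p ^ s := by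
    zify
    rw [Int.toNat_of_nonneg (by omega)]
    omega
  rw [eElt_eq_of_tmul, tableElt_of_eq σ π _ hk (a := a.val)]
  · congr 4
    · have : (((j + 1).toNat : ℕ) : F) = j + 1 := by
        rw [← Int.cast_natCast, Int.toNat_of_nonneg (by omega), Int.cast_add, Int.cast_one]
      rw [this]
      ring
    · rw [ZMod.castHom_apply, ZMod.cast_eq_val, Int.cast_natCast]
  · rw [Int.toNat_of_nonneg (by omega)]
    ring

theorem eDeg_eq_tableDeg (i : EIndex p n s) :
    eDeg p n s i.1 i.2.1 i.2.2 = tableDeg ((p ^ n - 1) * p ^ (s + 1)) (p ^ n)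
      (-((i.2.2.val : ℤ) * (p : ℤ) ^ s + i.2.1)) ((i.1 : ℤ) + 1).toNat := by
  have hj := i.1.2.1
  rw [eDeg, tableDeg, Int.toNat_of_nonneg (by omega)]
  congr 1
  push_cast
  ring

theorem cast_modulus : (((p ^ n - 1) * p ^ (s + 1) : ℕ) : ℤ)
    = ((p ^ n : ℕ) - 1 : ℤ) * (p : ℤ) ^ (s + 1) := by
  have : 0 < p ^ n := Nat.pow_pos (Fact.out : p.Prime).pos
  push_cast [Nat.cast_sub (show 1 ≤ p ^ n by omega)]
  ring

theorem tableDeg_periodic (m : ℕ) {t t' : ℤ} (h : (p : ℤ) ^ (s + 1) ∣ t - t') :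
    tableDeg ((p ^ n - 1) * p ^ (s + 1)) (p ^ n) t m
      = tableDeg ((p ^ n - 1) * p ^ (s + 1)) (p ^ n) t' m := by
  rw [tableDeg, tableDeg, ZMod.intCast_eq_intCast_iff_dvd_sub, cast_modulus]
  obtain ⟨c, hc⟩ := h
  exact ⟨-c, by linear_combination (1 - ((p ^ n : ℕ) : ℤ)) * hc⟩

/-- Equal degrees force `m' - m` to be a multiple of `q - 1`; as its absolute value is at most `q -
1`, the multiplier is `-1`, `0` or `1`. The outer cases are the two halves of a diamond. -/
theorem tableDeg_eq_cases (hq : 3 ≤ p ^ n) {m m' : ℕ} (hm : m < p ^ n) (hm' : m' < p ^ n)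
    {t t' : ℤ} (h : tableDeg ((p ^ n - 1) * p ^ (s + 1)) (p ^ n) t m
      = tableDeg ((p ^ n - 1) * p ^ (s + 1)) (p ^ n) t' m') :
    (m = m' ∧ (p : ℤ) ^ (s + 1) ∣ t' - t) ∨
      (m = 0 ∧ m' = p ^ n - 1 ∧ (p : ℤ) ^ (s + 1) ∣ t' - (t + 1)) ∨
      (m = p ^ n - 1 ∧ m' = 0 ∧ (p : ℤ) ^ (s + 1) ∣ t' + 1 - t) := by
  rw [tableDeg, tableDeg, ZMod.intCast_eq_intCast_iff_dvd_sub, cast_modulus] at h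
  generalize p ^ n = q at *
  obtain ⟨c, hc⟩ := h
  have hQ : (0 : ℤ) < (q : ℤ) - 1 := by omega
  have hdvd : ((m' : ℤ) - m) = ((q : ℤ) - 1) * (t' - t - (p : ℤ) ^ (s + 1) * c) := by
    linear_combination -hc
  have hle : t' - t - (p : ℤ) ^ (s + 1) * c ≤ 1 := by nlinarith
  have hge : -1 ≤ t' - t - (p : ℤ) ^ (s + 1) * c := by nlinarith
  generalize he : t' - t - (p : ℤ) ^ (s + 1) * c = e at *
  obtain rfl | rfl | rfl : e = -1 ∨ e = 0 ∨ e = 1 := by omega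
  · exact Or.inr (Or.inr ⟨by omega, by omega, c, by linarith⟩)
  · exact Or.inl ⟨by omega, c, by linarith⟩
  · exact Or.inr (Or.inl ⟨by omega, by omega, c, by linarith⟩)

theorem exists_eElt_eq_tableElt (σ π : F) {m : ℕ} (hm : m < p ^ n) (t : ℤ) :
    ∃ i : EIndex p n s, (i.1 : ℤ) = m - 1 ∧
      eElt p n s σ π i.1 i.2.1 i.2.2 = tableElt p n s σ π m t ∧
      eDeg p n s i.1 i.2.1 i.2.2 = tableDeg ((p ^ n - 1) * p ^ (s + 1)) (p ^ n) t m := by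
  obtain ⟨a, k, hk, ht⟩ := exists_table_coords p s t
  have hm' : (m : ℤ) < (p : ℤ) ^ n := by exact_mod_cast hm
  have hk' : (k : ℤ) < (p : ℤ) ^ s := by exact_mod_cast hk
  let i : EIndex p n s := (⟨(m : ℤ) - 1, by omega, by omega⟩,
    ⟨(k : ℤ) - 1, by omega, by omega⟩, (a : ZMod p))
  have hi : ((i.1 : ℤ) + 1).toNat = m := by
    change ((m : ℤ) - 1 + 1).toNat = m
    omega
  have hdvd : (p : ℤ) ^ (s + 1) ∣ -((i.2.2.val : ℤ) * (p : ℤ) ^ s + i.2.1) - t := by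
    have h1 : ((a : ZMod p).val : ℤ) = a % p := ZMod.val_intCast a
    have h2 := Int.emod_add_mul_ediv a p
    change (p : ℤ) ^ (s + 1) ∣ -(((a : ZMod p).val : ℤ) * (p : ℤ) ^ s + ((k : ℤ) - 1)) - t
    refine ⟨a / p, ?_⟩
    rw [h1, pow_succ]
    linear_combination ht - (p : ℤ) ^ s * h2
  refine ⟨i, rfl, ?_, ?_⟩
  · rw [eElt_eq_tableElt, hi, tableElt_periodic σ π m hdvd]
  · rw [eDeg_eq_tableDeg, hi, tableDeg_periodic m hdvd]

/-! ### The basis of the elements `e_{j,k,a}`. -/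

section Basis

instance : Module.Finite F (AlbertZassenhaus F p (s + 1) n) :=
  inferInstanceAs (Module.Finite F (DivPow₂ F p (s + 1) n))

theorem top_le_span_eElt {σ : F} (hσ : σ ≠ 0) (π : F) :
    ⊤ ≤ Submodule.span F (Set.range fun i : EIndex p n s =>
      eElt p n s σ π i.1 i.2.1 i.2.2) := by
  rintro z -
  obtain ⟨z, rfl⟩ := of.surjective z
  induction z using TensorProduct.induction_on with
  | zero =>
    rw [map_zero]
    exact zero_mem _
  | add f g hf hg =>
    rw [map_add]
    exact add_mem hf hg
  | tmul f g =>
    induction g using DivPow.induction with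
    | h0 =>
      rw [TensorProduct.tmul_zero, map_zero]
      exact zero_mem _
    | hadd f g hf hg =>
      rw [TensorProduct.tmul_add, map_add]
      exact add_mem hf hg
    | hsmul c f hf =>
      rw [TensorProduct.tmul_smul, map_smul]
      exact Submodule.smul_mem _ _ hf
    | hdp m hm =>
      refine Submodule.span_induction (p := fun f _ => of (f ⊗ₜ[F] DivPow.dp F p n m) ∈ _)
        ?_ ?_ ?_ ?_ (DivPow.mem_span_twistedDp σ hσ (-((m : F) - 1) * π) f)
      · rintro _ ⟨a, -, k, hk, rfl⟩
        obtain ⟨i, -, hi, -⟩ := exists_eElt_eq_tableElt (s := s) σ π hm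
          (1 - ((a : ℤ) * (p : ℤ) ^ s + k))
        rw [tableElt_of_eq σ π m hk (sub_sub_cancel _ _)] at hi
        refine Submodule.subset_span ⟨i, ?_⟩
        simpa using hi
      · rw [TensorProduct.zero_tmul, map_zero]
        exact zero_mem _
      · intro f g _ _ hf hg
        rw [TensorProduct.add_tmul, map_add]
        exact add_mem hf hg
      · intro c f _ hf
        rw [← TensorProduct.smul_tmul', map_smul]
        exact Submodule.smul_mem _ _ hf

theorem card_EIndex : Fintype.card (EIndex p n s) =
    Module.finrank F (AlbertZassenhaus F p (s + 1) n) := by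
  have h1 : Module.finrank F (AlbertZassenhaus F p (s + 1) n)
      = Module.finrank F (DivPow₂ F p (s + 1) n) := rfl
  rw [h1, Module.finrank_tensorProduct, DivPow.finrank_eq, DivPow.finrank_eq, Fintype.card_prod,
    Fintype.card_prod, ZMod.card]
  have h2 : ∀ k : ℕ, Fintype.card (Set.Ico (-1 : ℤ) ((p : ℤ) ^ k - 1)) = p ^ k := by
    intro k
    have h3 : (0 : ℤ) ≤ (p : ℤ) ^ k := by positivity
    zify
    rw [Int.card_fintype_Ico_of_le _ _ (by omega)]
    ring
  rw [h2, h2]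
  ring

/-- The basis of the elements `e_{j,k,a}`. -/
def eBasis {σ : F} (hσ : σ ≠ 0) (π : F) :
    Module.Basis (EIndex p n s) F (AlbertZassenhaus F p (s + 1) n) :=
  basisOfTopLeSpanOfCardEqFinrank (fun i : EIndex p n s => eElt p n s σ π i.1 i.2.1 i.2.2)
    (top_le_span_eElt hσ π) card_EIndex

theorem eBasis_apply {σ : F} (hσ : σ ≠ 0) (π : F) (i : EIndex p n s) :
    eBasis hσ π i = eElt p n s σ π i.1 i.2.1 i.2.2 := by
  rw [eBasis, coe_basisOfTopLeSpanOfCardEqFinrank]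

end Basis

/-! ### The cyclic grading. -/

section Grading

theorem tableElt_mem_eComponent (σ π : F) (m : ℕ) (t : ℤ) :
    tableElt p n s σ π m t ∈ eComponent p n s σ π
      (tableDeg ((p ^ n - 1) * p ^ (s + 1)) (p ^ n) t m) := by
  rcases Nat.lt_or_ge m (p ^ n) with hm | hm
  · obtain ⟨i, -, h1, h2⟩ := exists_eElt_eq_tableElt (s := s) σ π hm t
    exact Submodule.subset_span ⟨i, h2, h1.symm⟩
  · rw [tableElt_of_le σ π hm]
    exact zero_mem _

theorem eComponent_induction (σ π : F) {d : ZMod ((p ^ n - 1) * p ^ (s + 1))}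
    {P : AlbertZassenhaus F p (s + 1) n → Prop}
    (h : ∀ (m : ℕ) (t : ℤ), m < p ^ n →
      tableDeg ((p ^ n - 1) * p ^ (s + 1)) (p ^ n) t m = d → P (tableElt p n s σ π m t))
    (h0 : P 0) (hadd : ∀ u v, P u → P v → P (u + v)) (hsmul : ∀ (c : F) u, P u → P (c • u))
    {u : AlbertZassenhaus F p (s + 1) n} (hu : u ∈ eComponent p n s σ π d) : P u := by
  refine Submodule.span_induction (p := fun u _ => P u) ?_ h0 (fun u v _ _ => hadd u v)
    (fun c u _ => hsmul c u) hu
  rintro _ ⟨i, hi, rfl⟩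
  rw [eDeg_eq_tableDeg] at hi
  rw [eElt_eq_tableElt]
  refine h _ _ ?_ hi
  have h2 := i.1.2.1
  have h3 := i.1.2.2
  zify
  rw [Int.toNat_of_nonneg (by omega)]
  omega

theorem eComponent_le (σ π : F) {d : ZMod ((p ^ n - 1) * p ^ (s + 1))}
    {M : Submodule F (AlbertZassenhaus F p (s + 1) n)}
    (h : ∀ (m : ℕ) (t : ℤ), m < p ^ n →
      tableDeg ((p ^ n - 1) * p ^ (s + 1)) (p ^ n) t m = d → tableElt p n s σ π m t ∈ M) :
    eComponent p n s σ π d ≤ M :=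
  fun _ hu => eComponent_induction σ π (P := (· ∈ M)) h (zero_mem _)
    (fun _ _ => add_mem) (fun c _ => M.smul_mem c) hu

theorem lie_tableElt_mem {σ π : F} (hσπ : (π ^ p - π) * σ ^ p = 1) {m m' : ℕ} (hm : m < p ^ n)
    (hm' : m' < p ^ n) (t t' : ℤ) :
    ⁅tableElt p n s σ π m t, tableElt p n s σ π m' t'⁆ ∈ eComponent p n s σ π
      (tableDeg ((p ^ n - 1) * p ^ (s + 1)) (p ^ n) t m
        + tableDeg ((p ^ n - 1) * p ^ (s + 1)) (p ^ n) t' m') := by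
  rcases Nat.eq_zero_or_pos (m + m') with h0 | hmm
  · obtain ⟨rfl, rfl⟩ : m = 0 ∧ m' = 0 := by omega
    rw [lie_tableElt_zero]
    exact zero_mem _
  · have hdeg : tableDeg ((p ^ n - 1) * p ^ (s + 1)) (p ^ n) t m
        + tableDeg ((p ^ n - 1) * p ^ (s + 1)) (p ^ n) t' m'
        = tableDeg ((p ^ n - 1) * p ^ (s + 1)) (p ^ n) (t + t') (m + m' - 1) := by
      simp only [tableDeg]
      push_cast [Nat.cast_sub (show 1 ≤ m + m' by omega)]
      ring
    rw [hdeg]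
    obtain ⟨a, k, hk, ha⟩ := exists_table_coords p s t
    obtain ⟨a', k', hk', ha'⟩ := exists_table_coords p s t'
    rcases Nat.eq_zero_or_pos (k + k') with hkk | hkk
    · obtain ⟨rfl, rfl⟩ : k = 0 ∧ k' = 0 := by omega
      rw [lie_tableElt_of_zero hσπ hm hm' hmm (by simpa using ha) (by simpa using ha')]
      exact Submodule.smul_mem _ _ (tableElt_mem_eComponent _ _ _ _)
    · rw [lie_tableElt_of_pos σ π hm hm' hmm hk hk' ha ha' hkk]
      exact Submodule.smul_mem _ _ (tableElt_mem_eComponent _ _ _ _)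

theorem lie_mem_eComponent {σ π : F} (hσπ : (π ^ p - π) * σ ^ p = 1)
    {d d' : ZMod ((p ^ n - 1) * p ^ (s + 1))} {u w : AlbertZassenhaus F p (s + 1) n}
    (hu : u ∈ eComponent p n s σ π d) (hw : w ∈ eComponent p n s σ π d') :
    ⁅u, w⁆ ∈ eComponent p n s σ π (d + d') := by
  refine eComponent_induction σ π (P := fun u => ⁅u, w⁆ ∈ eComponent p n s σ π (d + d'))
    ?_ ?_ ?_ ?_ hu
  · rintro m t hm rfl
    refine eComponent_induction σ π (P := fun w => ⁅tableElt p n s σ π m t, w⁆ ∈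
      eComponent p n s σ π (_ + d')) ?_ ?_ ?_ ?_ hw
    · rintro m' t' hm' rfl
      exact lie_tableElt_mem hσπ hm hm' t t'
    · rw [lie_zero]
      exact zero_mem _
    · intro u v hu hv
      rw [lie_add]
      exact add_mem hu hv
    · intro c u hu
      rw [lie_smul]
      exact Submodule.smul_mem _ _ hu
  · rw [zero_lie]
    exact zero_mem _
  · intro u v hu hv
    rw [add_lie]
    exact add_mem hu hv
  · intro c u hu
    rw [smul_lie]
    exact Submodule.smul_mem _ _ hu

/-- The components are the spans of the parts of a basis partitioned by degree. -/
theorem isInternal_eComponent {σ : F} (hσ : σ ≠ 0) (π : F) :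
    DirectSum.IsInternal (eComponent p n s σ π) := by
  have himage : ∀ d, eComponent p n s σ π d = Submodule.span F
      (eBasis hσ π '' {i : EIndex p n s | eDeg p n s i.1 i.2.1 i.2.2 = d}) := by
    intro d
    rw [eComponent]
    congr 1
    ext z
    simp only [Set.mem_ofPred_eq, Set.mem_image, eBasis_apply]
    exact ⟨fun ⟨i, hi, h⟩ => ⟨i, hi, h.symm⟩, fun ⟨i, hi, h⟩ => ⟨i, hi, h.symm⟩⟩
  rw [DirectSum.isInternal_submodule_iff_iSupIndep_and_iSup_eq_top]
  constructor
  · intro d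
    have hle : (⨆ d', ⨆ (_ : d' ≠ d), eComponent p n s σ π d') ≤ Submodule.span F
        (eBasis hσ π '' {i : EIndex p n s | eDeg p n s i.1 i.2.1 i.2.2 ≠ d}) := by
      refine iSup₂_le fun d' hd' => ?_
      rw [himage]
      refine Submodule.span_mono (Set.image_mono ?_)
      rintro i rfl
      exact hd'
    refine Disjoint.mono_right hle ?_
    rw [himage]
    refine (eBasis hσ π).linearIndependent.disjoint_span_image ?_
    rw [Set.disjoint_left]
    exact fun i h1 h2 => h2 h1
  · rw [eq_top_iff, ← (eBasis hσ π).span_eq, Submodule.span_le]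
    rintro _ ⟨i, rfl⟩
    exact Submodule.mem_iSup_of_mem (eDeg p n s i.1 i.2.1 i.2.2)
      (Submodule.subset_span ⟨i, rfl, eBasis_apply hσ π i⟩)

theorem nonempty_gradedLieAlgebra {σ π : F} (hσ : σ ≠ 0) (hσπ : (π ^ p - π) * σ ^ p = 1) :
    Nonempty (GradedLieAlgebra (eComponent p n s σ π)) :=
  ⟨{ (isInternal_eComponent hσ π).chooseDecomposition with
      bracket_mem := fun _ _ _ _ hu hw => lie_mem_eComponent hσπ hu hw }⟩

end Grading

/-! ### The diamond table of the Albert–Zassenhaus algebra. -/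

section Table

open Classical in
variable (p s) in
/-- The scalar by which `ad Y` acts on `v 0 t`. -/
def coeffC (σ π : F) (t : ℤ) : F :=
  if (p : ℤ) ^ s ∣ 1 - t then -(σ * (π + ((1 - t) / (p : ℤ) ^ s : ℤ))) else -1

open Classical in
variable (p s) in
/-- The scalar by which `ad Y` acts on `v 1 t`. -/
def coeffD (σ π : F) (t : ℤ) : F :=
  if (p : ℤ) ^ s ∣ 1 - t then σ * (2 * π + ((1 - t) / (p : ℤ) ^ s : ℤ)) else 1

variable {σ π : F}

theorem notMem_bot_of_eq_one (hσπ : (π ^ p - π) * σ ^ p = 1) : π ∉ (⊥ : Subfield F) := by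
  intro h
  rw [Subfield.mem_bot_iff_pow_eq_self F p] at h
  rw [h, sub_self, zero_mul] at hσπ
  exact zero_ne_one hσπ

theorem coords_of_dvd {t : ℤ} (h : (p : ℤ) ^ s ∣ 1 - t) :
    1 - t = ((1 - t) / (p : ℤ) ^ s) * (p : ℤ) ^ s :=
  (Int.ediv_mul_cancel h).symm

/-- The scalars are read off the bracket formulas at the coordinates of the generators: `a = 0`, `k
= 1`, `m = 0` for `X` and `a = k = 0`, `m = q - 1` for `Y`. A zero among them would put `π` or `2π`,
hence `π`, into the prime field. -/
theorem isDiamondTable (hp : Odd p) (hn : 0 < n) (hs : 0 < s)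
    (hσπ : (π ^ p - π) * σ ^ p = 1) :
    IsDiamondTable (eComponent p n s σ π) (p ^ n) (tableElt p n s σ π)
      (coeffC p s σ π) (coeffD p s σ π) := by
  have hprime := (Fact.out : p.Prime)
  have h3 : 3 ≤ p := by
    have := hprime.two_le
    obtain ⟨k, hk⟩ := hp
    omega
  have hq : 3 ≤ p ^ n := h3.trans (Nat.le_self_pow hn.ne' p)
  have hr : 3 ≤ p ^ s := h3.trans (Nat.le_self_pow hs.ne' p)
  have hσ : σ ≠ 0 := by
    rintro rfl
    simp [hprime.ne_zero] at hσπ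
  have hπ := notMem_bot_of_eq_one hσπ
  have h2 : (2 : F) ≠ 0 := by
    have := (CharP.cast_eq_zero_iff F p 2).not.2 (fun h => by
      have := Nat.le_of_dvd two_pos h
      omega)
    exact_mod_cast this
  have hqF : ((p ^ n : ℕ) : F) = 0 := by
    rw [Nat.cast_pow, CharP.cast_eq_zero, zero_pow hn.ne']
  have hint : ∀ z : ℤ, (z : F) ∈ (⊥ : Subfield F) := fun z => intCast_mem _ z
  -- coordinates of the generators
  have hX : 1 - (0 : ℤ) = 0 * (p : ℤ) ^ s + (1 : ℕ) := by simp
  have hY : 1 - (1 : ℤ) = 0 * (p : ℤ) ^ s := by simp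
  have hY' : 1 - (1 : ℤ) = 0 * (p : ℤ) ^ s + (0 : ℕ) := by simp
  have hnz : ∀ t m, m < p ^ n → tableElt p n s σ π m t ≠ 0 := by
    intro t m hm
    obtain ⟨i, -, hi, -⟩ := exists_eElt_eq_tableElt (s := s) σ π hm t
    rw [← hi, ← eBasis_apply hσ]
    exact (eBasis hσ π).ne_zero i
  -- the coordinates of an arbitrary degree, with the divisibility that governs the scalars
  have hcoord : ∀ t : ℤ, ¬ (p : ℤ) ^ s ∣ 1 - t → ∃ (a : ℤ) (k : ℕ), 0 < k ∧ k < p ^ s ∧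
      1 - t = a * (p : ℤ) ^ s + k := by
    intro t ht
    obtain ⟨a, k, hk, h⟩ := exists_table_coords p s t
    refine ⟨a, k, Nat.pos_of_ne_zero ?_, hk, h⟩
    rintro rfl
    exact ht ⟨a, by rw [h]; push_cast; ring⟩
  refine
    { three_le := hq
      bracket_mem := fun hu hw => lie_mem_eComponent hσπ hu hw
      component := ?_
      diamond := ?_
      ne_zero := fun t m _ hm => hnz t m (by omega)
      linearIndependent := ?_
      lie_X := ?_
      lie_X_zero := fun t => lie_tableElt_zero σ π t 0
      lie_Y := ?_
      lie_Y_one := ?_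
      lie_Y_zero := ?_
      c_ne := ?_
      d_ne := ?_ }
  · intro t m h1 hm
    refine le_antisymm (eComponent_le σ π ?_) ?_
    · intro m' t' hm' h
      rcases tableDeg_eq_cases hq hm' (by omega) h with ⟨rfl, h'⟩ | ⟨-, h', -⟩ | ⟨-, h', -⟩
      · rw [← tableElt_periodic σ π m' h']
        exact Submodule.mem_span_singleton_self _
      · omega
      · omega
    · rw [Submodule.span_singleton_le_iff_mem]
      exact tableElt_mem_eComponent σ π m t
  · intro t
    have hdeg : tableDeg ((p ^ n - 1) * p ^ (s + 1)) (p ^ n) (t + 1) (p ^ n - 1)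
        = tableDeg ((p ^ n - 1) * p ^ (s + 1)) (p ^ n) t 0 := by
      rw [tableDeg, tableDeg, Nat.cast_sub (by omega)]
      congr 1
      push_cast
      ring
    refine le_antisymm (eComponent_le σ π ?_) (Submodule.span_le.2 ?_)
    · intro m' t' hm' h
      rcases tableDeg_eq_cases hq hm' (by omega) h with ⟨rfl, h'⟩ | ⟨-, h', -⟩ | ⟨rfl, -, h'⟩
      · rw [← tableElt_periodic σ π 0 h']
        exact Submodule.subset_span (by simp)
      · omega
      · rw [← tableElt_periodic σ π _ h']
        exact Submodule.subset_span (by simp)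
    · rintro _ (rfl | rfl)
      · exact tableElt_mem_eComponent σ π 0 t
      · rw [← hdeg]
        exact tableElt_mem_eComponent σ π _ _
  · intro t
    obtain ⟨i, hi, hi', -⟩ := exists_eElt_eq_tableElt (n := n) (s := s) σ π (m := 0) (by omega) t
    obtain ⟨i', hj, hj', -⟩ := exists_eElt_eq_tableElt (n := n) (s := s) σ π (m := p ^ n - 1)
      (by omega) (t + 1)
    have hne : i ≠ i' := by
      rintro rfl
      rw [hi] at hj
      omega
    have h := (eBasis hσ π).linearIndependent.comp ![i, i'] (by
      rw [injective_pair_iff_ne]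
      exact hne)
    have heq : eBasis hσ π ∘ ![i, i'] =
        ![tableElt p n s σ π 0 t, tableElt p n s σ π (p ^ n - 1) (t + 1)] := by
      ext x
      fin_cases x
      · simp [eBasis_apply, hi']
      · simp [eBasis_apply, hj']
    exact heq ▸ h
  · intro t m hm
    obtain ⟨a, k, hk, h⟩ := exists_table_coords p s t
    rw [lie_tableElt_of_pos σ π hm (by omega) (by omega) hk (by omega) h hX (by omega)]
    simp
  · intro t m h1 hm
    obtain ⟨a, k, hk, h⟩ := exists_table_coords p s t
    -- For `m ≥ 2` the exponent of `y` reaches `q`.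
    have h0 : tableElt p n s σ π (m + (p ^ n - 1) - 1) (t + 1) = 0 :=
      tableElt_of_le σ π (by omega) _
    rcases Nat.eq_zero_or_pos k with rfl | hk0
    · rw [lie_tableElt_of_zero hσπ hm (by omega) (by omega) (by simpa using h) hY, h0, smul_zero]
    · rw [lie_tableElt_of_pos σ π hm (by omega) (by omega) hk (by omega) h hY' (by omega), h0,
        smul_zero]
  · intro t
    by_cases ht : (p : ℤ) ^ s ∣ 1 - t
    -- In `F` one has `q = 0`, so the exponent `-(q-2)π` of `Y` is `2π` and `binom(q-1, 1) = -1`.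
    · rw [lie_tableElt_of_zero hσπ (by omega) (by omega) (by omega) (coords_of_dvd ht) hY,
        coeffD, if_pos ht, show 1 + (p ^ n - 1) - 1 = p ^ n - 1 by omega, Nat.choose_self,
        Nat.choose_one_right, Nat.cast_sub (by omega), hqF]
      congr 1
      push_cast
      ring
    · obtain ⟨a, k, hk0, hk, h⟩ := hcoord t ht
      rw [lie_tableElt_of_pos σ π (by omega) (by omega) (by omega) hk (by omega) h hY' (by omega),
        coeffD, if_neg ht, show 1 + (p ^ n - 1) - 1 = p ^ n - 1 by omega,
        Nat.choose_eq_zero_of_lt (show k + 0 - 1 < k by omega), Nat.choose_zero_right,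
        Nat.choose_one_right, Nat.cast_sub (by omega), hqF]
      congr 1
      push_cast
      ring
  · intro t
    have hlt : (p ^ n - 2).choose (p ^ n - 1) = 0 := Nat.choose_eq_zero_of_lt (by omega)
    by_cases ht : (p : ℤ) ^ s ∣ 1 - t
    · rw [lie_tableElt_of_zero hσπ (by omega) (by omega) (by omega) (coords_of_dvd ht) hY,
        coeffC, if_pos ht, show 0 + (p ^ n - 1) - 1 = p ^ n - 2 by omega, hlt,
        Nat.choose_zero_right]
      congr 1
      push_cast
      ring
    · obtain ⟨a, k, hk0, hk, h⟩ := hcoord t ht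
      rw [lie_tableElt_of_pos σ π (by omega) (by omega) (by omega) hk (by omega) h hY' (by omega),
        coeffC, if_neg ht, show 0 + (p ^ n - 1) - 1 = p ^ n - 2 by omega, hlt,
        Nat.choose_zero_right, Nat.choose_zero_right]
      congr 1
      push_cast
      ring
  · intro t
    rw [coeffC]
    split_ifs
    · refine neg_ne_zero.2 (mul_ne_zero hσ fun h => hπ ?_)
      rw [eq_neg_of_add_eq_zero_left h]
      exact neg_mem (hint _)
    · exact neg_ne_zero.2 one_ne_zero
  · intro t
    rw [coeffD]
    split_ifs
    · refine mul_ne_zero hσ fun h => hπ ?_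
      have h4 : π = -(((1 - t) / (p : ℤ) ^ s : ℤ) : F) / 2 := by
        rw [eq_div_iff h2]
        linear_combination h
      rw [h4]
      refine div_mem (neg_mem (hint _)) ?_
      exact_mod_cast hint 2
    · exact one_ne_zero

theorem coeffC_add_coeffD {t : ℕ} (h : ¬ t ≡ 1 [MOD p ^ s]) :
    coeffC p s σ π t + coeffD p s σ π t = 0 := by
  have h' : ¬ (p : ℤ) ^ s ∣ 1 - (t : ℤ) := by
    rw [Nat.modEq_iff_dvd] at h
    exact_mod_cast h
  rw [coeffC, coeffD, if_neg h', if_neg h', neg_add_cancel]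

/-- Here `1 - t = -m p^s`, so `a = -m`. The sum of the two scalars is `σπ` for every `m`, which is
why the types are in arithmetic progression. -/
theorem coeff_at_finite (m : ℕ) :
    coeffC p s σ π ((m * p ^ s + 1 : ℕ) : ℤ) = -(σ * (π - m)) ∧
      coeffD p s σ π ((m * p ^ s + 1 : ℕ) : ℤ) = σ * (2 * π - m) := by
  have hpos : (p : ℤ) ^ s ≠ 0 := pow_ne_zero _ (by exact_mod_cast (Fact.out : p.Prime).ne_zero)
  have h1 : 1 - ((m * p ^ s + 1 : ℕ) : ℤ) = -(m : ℤ) * (p : ℤ) ^ s := by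
    push_cast
    ring
  have hdvd : (p : ℤ) ^ s ∣ 1 - ((m * p ^ s + 1 : ℕ) : ℤ) := ⟨-m, by rw [h1, mul_comm]⟩
  rw [coeffC, coeffD, if_pos hdvd, if_pos hdvd, h1, Int.mul_ediv_cancel _ hpos]
  push_cast
  exact ⟨by ring, by ring⟩

end Table

end AlbertZassenhaus

end

/-! ### Assembly of the theorem. -/

open AlbertZassenhaus in
theorem theorem5p1 {F : Type*} [Field F] {p : ℕ} [Fact p.Prime] [CharP F p] (hp : Odd p)
    (n s : ℕ) (hn : 0 < n) (hs : 0 < s) (σ π : F) (hσπ : (π ^ p - π) * σ ^ p = 1) :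
    -- the elements `e_{j,k,a}` form a basis, graded by the stated degrees
    (∃ b : Module.Basis (EIndex p n s) F (AlbertZassenhaus F p (s + 1) n),
      ∀ i : EIndex p n s, b i = eElt p n s σ π i.1 i.2.1 i.2.2) ∧
    Nonempty (GradedLieAlgebra (eComponent p n s σ π)) ∧
    -- the loop algebra is thin, with second diamond in degree `q = p ^ n`
    IsThin (loopComponent (eComponent p n s σ π)) ∧
    SecondDiamondAt (loopComponent (eComponent p n s σ π)) (p ^ n) ∧
    -- the degrees of the diamonds
    (∀ i, IsDiamond (loopComponent (eComponent p n s σ π)) i ↔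
      ∃ t : ℕ, i = t * (p ^ n - 1) + 1) ∧
    -- the types of the diamonds
    (∃ X Y : cyclicLoopAlgebra (eComponent p n s σ π),
      IsNottinghamPair (loopComponent (eComponent p n s σ π)) (p ^ n) X Y ∧
      HasDiamondPattern (loopComponent (eComponent p n s σ π)) X Y (p ^ n) (p ^ s)
        (-1 + 1 / π)) ∧
    (3 < p ^ n → ∀ X Y : cyclicLoopAlgebra (eComponent p n s σ π),
      IsNottinghamPair (loopComponent (eComponent p n s σ π)) (p ^ n) X Y →
      HasDiamondPattern (loopComponent (eComponent p n s σ π)) X Y (p ^ n) (p ^ s)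
        (-1 + 1 / π)) := by
  have hσ : σ ≠ 0 := by
    rintro rfl
    simp [(Fact.out : p.Prime).ne_zero] at hσπ
  have hπ := notMem_bot_of_eq_one hσπ
  have hπ0 : π ≠ 0 := fun h => hπ (h ▸ zero_mem _)
  have H := isDiamondTable hp hn hs hσπ
  have hfin : ∀ m : ℕ, coeffC p s σ π ((m * p ^ s + 1 : ℕ) : ℤ) = (-1 + m * (1 / π)) *
      (coeffC p s σ π ((m * p ^ s + 1 : ℕ) : ℤ) + coeffD p s σ π ((m * p ^ s + 1 : ℕ) : ℤ)) := by
    intro m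
    rw [(coeff_at_finite m).1, (coeff_at_finite m).2]
    field_simp
    ring
  have hδ : 1 / π ∉ (⊥ : Subfield F) := by
    intro h
    have := inv_mem h
    rw [one_div, inv_inv] at this
    exact hπ this
  -- At the second diamond `c 1 = -σπ` and `d 1 = 2σπ`: their ratio gives the factor `-2` required
  -- of standard generators, and their sum `σπ ≠ 0` gives the uniqueness of these up to scalars when
  -- `q > 3`.
  obtain ⟨hc1, hd1⟩ := coeff_at_finite (s := s) (σ := σ) (π := π) (p := p) 0
  simp only [zero_mul, zero_add, Nat.cast_one, Nat.cast_zero, sub_zero] at hc1 hd1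
  have hX := H.isCyclicallyCovered.tmul_mem_cyclicLoopAlgebra (i := 1) le_rfl
    (by simpa using H.X_mem)
  have hY := H.isCyclicallyCovered.tmul_mem_cyclicLoopAlgebra (i := 1) le_rfl
    (by simpa using H.Y_mem)
  refine ⟨⟨eBasis hσ π, eBasis_apply hσ π⟩, nonempty_gradedLieAlgebra hσ hσπ, H.isThin,
    H.secondDiamondAt, H.isDiamond_iff, ⟨⟨_, hX⟩, ⟨_, hY⟩, ?_, ?_⟩, ?_⟩
  · refine H.isNottinghamPair one_ne_zero one_ne_zero (by rw [one_smul]) (by rw [one_smul]) ?_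
    rw [hc1, hd1]
    ring
  · exact H.hasDiamondPattern one_ne_zero one_ne_zero (by rw [one_smul]) (by rw [one_smul])
      (fun t => coeffC_add_coeffD) hfin hδ
  · intro h3 X Y hXY
    obtain ⟨a, b, ha, hb, hX', hY'⟩ := H.exists_of_isNottinghamPair h3 (by
      rw [hc1, hd1]
      intro h
      exact mul_ne_zero hσ hπ0 (by linear_combination h)) hXY
    exact H.hasDiamondPattern ha hb hX' hY' (fun t => coeffC_add_coeffD) hfin hδ
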